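/- Let $n\ge 2$ be an integer and $\alpha\in(0,1)\cup(1,\infty)$. For a probability vector $\mathbf p$ put $H(\mathbf p)=-\sum_i p_i\ln p_i$ (with $0\ln 0=0$) and $\|\mathbf p\|_\alpha=(\sum_i p_i^\alpha)^{1/\alpha}$. Let $\mathbf u_m$ be the uniform distribution on $m$ points; for $p\in[0,\frac1n]$ let $\mathbf v_n(p)=(1-(n-1)p,\,p,\dots,p)\in\mathbb R^n$ and $H_{\mathbf v_n}(p)=H(\mathbf v_n(p))$, and let $H_{\mathbf v_n}^{-1}:[0,\ln n]\to[0,\frac1n]$ be its inverse; for $p\in[\frac1n,1]$ let $\mathbf w_n(p)\in\mathbb R^n$ be the vector with $\lfloor 1/p\rfloor$ entries equal to $p$, followed (if $\lfloor 1/p\rfloor<n$) by the entry $1-\lfloor 1/p\rfloor p$ and zeros. For a pair of random variables $(X,Y)$, where $X$ takes values in a set of $n$ elements and $Y$ takes values in an arbitrary measurable space, let $H(X|Y)=\mathbb E[H(P_{X|Y}(\cdot|Y))]$. For $h\in[0,\ln n]$ define $$L_{\min}^\alpha(h)=\lambda\|\mathbf u_m\|_\alpha+(1-\lambda)\|\mathbf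 u_{m+1}\|_\alpha,\qquad m=\lfloor e^h\rfloor,\quad \lambda=\frac{\ln(m+1)-h}{\ln(m+1)-\ln m}.$$ Put $p_2^*(\alpha)=\frac12$. For $n\ge3$ and $\alpha\in[\frac12,1)\cup(1,\infty)$, the equation $$(\ln n-H_{\mathbf v_n}(p))\,\frac{\partial\|\mathbf v_n(p)\|_\alpha}{\partial H_{\mathbf v_n}(p)}=\|\mathbf u_n\|_\alpha-\|\mathbf v_n(p)\|_\alpha$$ has exactly one root $p\in(0,\frac1n)$; call it $p_n^*(\alpha)$. Write $p^*=p_n^*(\alpha)$ and $h^*=H_{\mathbf v_n}(p^*)$, and define $$L_{\max}^\alpha(h)=\begin{cases}\|\mathbf v_n(H_{\mathbf v_n}^{-1}(h))\|_\alpha & \text{if } h\le h^*,\\ \lambda\|\mathbf v_n(p^*)\|_\alpha+(1-\lambda)\|\mathbf u_n\|_\alpha,\quad \lambda=\dfrac{\ln n-h}{\ln n-h^*} & \text{if } h>h^*.\end{cases}$$ Then for every such $(X,Y)$: (a) $L_{\min}^\alpha(H(X|Y))\le\mathbb E[\|P_{X|Y}(\cdot|Y)\|_\alpha]$ for all $\alpha\in(0,1)\cup(1,\infty)$;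 (b) $\mathbb E[\|P_{X|Y}(\cdot|Y)\|_\alpha]\le L_{\max}^\alpha(H(X|Y))$ for all $\alpha\in[\frac12,1)\cup(1,\infty)$, and, if $n=2$, also for $\alpha\in(0,\frac12)$. Both bounds are tight, with $Y$ taking values in $\{0,1\}$: (c) Equality holds in (a) whenever, for some integer $1\le m\le n-1$, $P_{X|Y}(\cdot|y)=\mathbf w_n(\frac1{m+y})$ for $y\in\{0,1\}$ (with any law of $Y$). For every $h\in[0,\ln n]$ there is such a pair with $H(X|Y)=h$. (d) For all $\alpha$ to which (b) applies, equality holds in (b) whenever either $H(X|Y)\le h^*$ and $P_{X|Y}(\cdot|y)=\mathbf v_n(p)$ for both $y\in\{0,1\}$ and some $p\in[0,p^*]$, or $H(X|Y)>h^*$ and $P_{X|Y}(\cdot|0)=\mathbf v_n(p^*)$, $P_{X|Y}(\cdot|1)=\mathbf u_n$. For every $h\in[0,\ln n]$ there is such a pair with $H(X|Y)=h$. -/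

import Mathlib

open MeasureTheory ProbabilityTheory

noncomputable section

namespace CondExtremes

/-- Shannon entropy (in nats) of a vector on a finite alphabet; `0 * log 0 = 0`. -/
def shannonEntropy {ι : Type*} [Fintype ι] (p : ι → ℝ) : ℝ :=
  -∑ i, p i * Real.log (p i)

/-- The `ℓ_α`-norm `(∑ i, p_i ^ α) ^ (1 / α)` of a nonnegative vector, for `α > 0`. -/
def lnorm {ι : Type*} [Fintype ι] (α : ℝ) (p : ι → ℝ) : ℝ :=
  (∑ i, p i ^ α) ^ (1 / α)

/-- The equiprobable vector `u_n`. -/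
def u (n : ℕ) : Fin n → ℝ := fun _ => 1 / (n : ℝ)

/-- The vector `v_n(p) = (1 - (n-1) p, p, …, p)`, used for `p ∈ [0, 1/n]`. -/
def v (n : ℕ) (p : ℝ) : Fin n → ℝ :=
  fun i => if i.val = 0 then 1 - ((n : ℝ) - 1) * p else p

/-- The vector `w_n(p) = (p, …, p, 1 - ⌊1/p⌋ p, 0, …, 0)` with `⌊1/p⌋` leading entries `p`,
used for `p ∈ [1/n, 1]` (indices start at `0` here). -/
def w (n : ℕ) (p : ℝ) : Fin n → ℝ :=
  fun i =>
    if i.val < ⌊p⁻¹⌋₊ then p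
    else if i.val = ⌊p⁻¹⌋₊ then 1 - (⌊p⁻¹⌋₊ : ℝ) * p
    else 0

/-- `H_{v_n}(p) = H(v_n(p))`. -/
def Hv (n : ℕ) (p : ℝ) : ℝ := shannonEntropy (v n p)

/-- The inverse `[0, ln n] → [0, 1/n]` of `p ↦ H(v_n(p))` on `[0, 1/n]`. -/
def HvInv (n : ℕ) (h : ℝ) : ℝ :=
  Function.invFunOn (Hv n) (Set.Icc (0 : ℝ) (1 / (n : ℝ))) h

/-- The value of `‖v_n(p)‖_α` as a function of the entropy `h = H(v_n(p)) ∈ [0, ln n]`. -/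
def vCurve (n : ℕ) (α h : ℝ) : ℝ := lnorm α (v n (HvInv n h))

/-- `p ∈ (0, 1/n)` solves
`(ln n - H_{v_n}(p)) * ∂‖v_n(p)‖_α / ∂H_{v_n}(p) = ‖u_n‖_α - ‖v_n(p)‖_α`. -/
def IsTangencyRoot (n : ℕ) (α p : ℝ) : Prop :=
  p ∈ Set.Ioo (0 : ℝ) (1 / (n : ℝ)) ∧
    (Real.log n - Hv n p) * deriv (vCurve n α) (Hv n p) = lnorm α (u n) - lnorm α (v n p)

/-- `p_n^*(α)`: it is `1/2` for `n = 2`, and the root of the tangency equation for `n ≥ 3`. -/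
def pStar (n : ℕ) (α : ℝ) : ℝ :=
  if n = 2 then 1 / 2 else Classical.epsilon (IsTangencyRoot n α)

/-- The lower bound as a function of the conditional entropy `h`: the linear interpolation
of the values `‖u_m‖_α` at the points `ln m`. -/
def Lmin (α h : ℝ) : ℝ :=
  let m : ℕ := ⌊Real.exp h⌋₊
  let lam : ℝ := (Real.log ((m : ℝ) + 1) - h) / (Real.log ((m : ℝ) + 1) - Real.log m)
  lam * lnorm α (u m) + (1 - lam) * lnorm α (u (m + 1))

/-- The tangent line through the points of `v_n(p_n^*(α))` and of `u_n`. -/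
def tangentLine (n : ℕ) (α h : ℝ) : ℝ :=
  let lam : ℝ := (Real.log n - h) / (Real.log n - Hv n (pStar n α))
  lam * lnorm α (v n (pStar n α)) + (1 - lam) * lnorm α (u n)

/-- The upper bound as a function of the conditional entropy `h`. -/
def Lmax (n : ℕ) (α h : ℝ) : ℝ :=
  if h ≤ Hv n (pStar n α) then vCurve n α h else tangentLine n α h

section RandomVariables

variable {Ω : Type*} [MeasurableSpace Ω]
  {A : Type*} [Fintype A] [Nonempty A] [MeasurableSpace A] [DiscreteMeasurableSpace A]
  {B : Type*} [MeasurableSpace B]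

/-- The probability vector `P_{X|Y}(· | y)`, from the regular conditional distribution. -/
def condVec (μ : Measure Ω) [IsFiniteMeasure μ] (X : Ω → A) (Y : Ω → B) (y : B) : A → ℝ :=
  fun x => (condDistrib X Y μ y).real {x}

/-- Conditional Shannon entropy `H(X|Y) = E[H(P_{X|Y}(·|Y))]`
(the integrand is bounded and measurable for measurable `Y`). -/
def condEntropy (μ : Measure Ω) [IsFiniteMeasure μ] (X : Ω → A) (Y : Ω → B) : ℝ :=
  ∫ ω, shannonEntropy (condVec μ X Y (Y ω)) ∂μ

/-- `E[‖P_{X|Y}(·|Y)‖_α]` (for `α > 0`, the integrand is bounded and measurable for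
measurable `Y`). -/
def expNorm (α : ℝ) (μ : Measure Ω) [IsFiniteMeasure μ] (X : Ω → A) (Y : Ω → B) : ℝ :=
  ∫ ω, lnorm α (condVec μ X Y (Y ω)) ∂μ

end RandomVariables

section Extremal

variable {Ω : Type*} [MeasurableSpace Ω]

/-- The pair `(X, Y)` with binary `Y` has joint law `P_{XY}(x, y) = P_Y(y) q(x|y)`. -/
def HasCondLaw {n : ℕ} (μ : Measure Ω) (X : Ω → Fin n) (Y : Ω → Fin 2)
    (q : Fin 2 → Fin n → ℝ) : Prop :=
  Measurable X ∧ Measurable Y ∧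
    ∀ x y, μ.real {ω | X ω = x ∧ Y ω = y} = μ.real {ω | Y ω = y} * q y x

/-- The two-point construction for the lower bound: `Y ∈ {0, 1}` and
`P_{X|Y}(·|y) = w_n(1/(m+y))` for some `1 ≤ m ≤ n - 1`; the law of `Y` is arbitrary. -/
def IsMinPair {n : ℕ} (μ : Measure Ω) (X : Ω → Fin n) (Y : Ω → Fin 2) : Prop :=
  ∃ m : ℕ, 1 ≤ m ∧ m < n ∧ HasCondLaw μ X Y (fun y => w n ((m : ℝ) + (y.val : ℝ))⁻¹)

/-- The two-point construction for the upper bound: `Y ∈ {0, 1}`; if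
`H(X|Y) ≤ H_{v_n}(p_n^*(α))`, then `P_{X|Y}(·|y) = v_n(p)` for both `y` and some
`p ∈ [0, p_n^*(α)]`; if `H(X|Y) > H_{v_n}(p_n^*(α))`, then
`P_{X|Y}(·|0) = v_n(p_n^*(α))` and `P_{X|Y}(·|1) = u_n`. -/
def IsMaxPair {n : ℕ} [NeZero n] (α : ℝ) (μ : Measure Ω) [IsFiniteMeasure μ]
    (X : Ω → Fin n) (Y : Ω → Fin 2) : Prop :=
  (condEntropy μ X Y ≤ Hv n (pStar n α) ∧
      ∃ p ∈ Set.Icc (0 : ℝ) (pStar n α), HasCondLaw μ X Y (fun _ => v n p)) ∨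
    (Hv n (pStar n α) < condEntropy μ X Y ∧
      HasCondLaw μ X Y (fun y => if y = 0 then v n (pStar n α) else u n))

end Extremal

end CondExtremes

end

open CondExtremes

/-!
The argument studies the region of the pairs `(H(P), ‖P‖_α)` as `P` runs through the simplex. The
pair `(H(X|Y), E‖P_{X|Y}‖_α)` is an average of such points, so an affine inequality
`‖P‖_α ≤ a + b H(P)` or `‖P‖_α ≥ a + b H(P)` valid on the simplex passes to the expectations. Each
bound therefore reduces to the supporting lines of the region.

Such a line has a slope `b` with `b (1 - α) > 0`, and the extrema of `‖P‖_α - b H(P)` are found by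
linearization. At an optimizer, either the norm is replaced by its tangent in `∑ P_i ^ α`, or, after
normalising `∑ x_i ^ α = 1` instead of `∑ x_i = 1`, the function `S log S` of `S = ∑ x_i` is
replaced by its tangent; the sign of the convexity decides which of the two keeps the optimizer optimal.
What remains is a separable sum whose summand has one inflection point, and moving mass between two
entries shows that a maximizer is some `v_n(p)` (`two_level_of_isMax_lnorm`) and that a minimizer
has `k` equal entries, one smaller entry, and zeros (`two_level_of_isMin_lnorm`).

Along the probability vectors with `k` entries `y` and `l` entries `t ≤ y`, the slope `d‖·‖_α / dH`
is an explicit function `levelSlope` of `L = log (y / t)`, whose derivative has the sign of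
`k e^L φ((α - 1) L) - l φ((1 - α) L)` with `φ(q) = e^q - 1 - q`. The ratio `curvRatio` of the two
`φ`-terms increases strictly from `1` to `∞`. So for `l ≤ k` the curve is concave, and it lies above
its chords (`levelCurve_chord`) and below its tangents; for `k < l` it is concave and then convex,
so a unique tangent meets the point of the uniform vector (`exists_unique_tangency`).

The lower bound follows from the first case with `l = 1`, since the points of the `u_m` lie on the
graph of the convex function `h ↦ exp ((1 / α - 1) h)`. The upper bound uses `k = 1` and
`l = n - 1`: its supporting lines are the tangents of the curve of the `v_n(p)` up to `p_n^*(α)`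
(for `n = 2`, where `k = l`, all of its tangents). The constructions with binary `Y` put the average
on these lines. -/

namespace CondExtremes

/-! ### The slope along the two-level vectors -/

/-- The remainder `e ^ q - 1 - q` of the exponential after its linear part. -/
noncomputable def expRem (q : ℝ) : ℝ := Real.exp q - 1 - q

theorem expRem_pos {q : ℝ} (hq : q ≠ 0) : 0 < expRem q := by
  have := Real.add_one_lt_exp hq
  unfold expRem; linarith

theorem hasDerivAt_expRem (q : ℝ) : HasDerivAt expRem (Real.exp q - 1) q :=
  ((Real.hasDerivAt_exp q).sub_const 1).sub (hasDerivAt_id q)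

theorem expRem_neg_lt {a : ℝ} (ha : 0 < a) : expRem (-a) < expRem a := by
  have := Real.self_lt_sinh_iff.2 ha
  rw [Real.sinh_eq] at this
  unfold expRem; linarith

/-- This is `tanh (a / 2) < a / 2`, cleared of denominators. -/
theorem two_mul_exp_sub_one_lt {a : ℝ} (ha : 0 < a) :
    2 * (Real.exp a - 1) < a * (Real.exp a + 1) := by
  have hd : ∀ x : ℝ, HasDerivAt (fun x => x * (Real.exp x + 1) - 2 * (Real.exp x - 1))
      (1 * (Real.exp x + 1) + x * Real.exp x - 2 * Real.exp x) x := fun x =>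
    ((hasDerivAt_id x).mul ((Real.hasDerivAt_exp x).add_const 1)).sub
      (((Real.hasDerivAt_exp x).sub_const 1).const_mul 2)
  have hmono : StrictMonoOn (fun x => x * (Real.exp x + 1) - 2 * (Real.exp x - 1)) (Set.Ici 0) := by
    refine strictMonoOn_of_deriv_pos (convex_Ici 0)
      (fun x _ => (hd x).continuousAt.continuousWithinAt) fun x hx => ?_
    rw [interior_Ici] at hx
    rw [(hd x).deriv]
    have h1 := Real.add_one_lt_exp (neg_ne_zero.2 (ne_of_gt hx))
    have h2 := Real.exp_pos x
    have h3 : Real.exp x * Real.exp (-x) = 1 := by rw [← Real.exp_add]; simp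
    nlinarith [mul_lt_mul_of_pos_left h1 h2]
  have := hmono (Set.self_mem_Ici) ha.le ha
  simp at this
  linarith

theorem expRem_lt_exp_mul {a : ℝ} (ha : 0 < a) :
    expRem a < Real.exp a * expRem (-a) := by
  have h3 : Real.exp a * Real.exp (-a) = 1 := by rw [← Real.exp_add]; simp
  have := two_mul_exp_sub_one_lt ha
  unfold expRem
  nlinarith

theorem strictMonoOn_exp_mul_expRem_ratio :
    StrictMonoOn (fun a => Real.exp a * expRem (-a) / expRem a) (Set.Ioi 0) := by
  have hd : ∀ a ∈ Set.Ioi (0 : ℝ), HasDerivAt (fun a => Real.exp a * expRem (-a) / expRem a)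
      (((Real.exp a * expRem (-a) + Real.exp a * ((Real.exp (-a) - 1) * (-1))) * expRem a
        - Real.exp a * expRem (-a) * (Real.exp a - 1)) / expRem a ^ 2) a := fun a ha =>
    ((Real.hasDerivAt_exp a).mul ((hasDerivAt_expRem (-a)).comp a (hasDerivAt_neg a))).div
      (hasDerivAt_expRem a) (expRem_pos (ne_of_gt ha)).ne'
  refine strictMonoOn_of_deriv_pos (convex_Ioi 0)
    (fun x hx => (hd x hx).continuousAt.continuousWithinAt) fun a ha => ?_
  rw [interior_Ioi] at ha
  rw [(hd a ha).deriv]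
  refine div_pos ?_ (pow_pos (expRem_pos (ne_of_gt ha)) 2)
  have h3 : Real.exp a * Real.exp (-a) = 1 := by rw [← Real.exp_add]; simp
  have hs : a / 2 < Real.sinh (a / 2) := Real.self_lt_sinh_iff.2 (half_pos ha)
  rw [Real.sinh_eq] at hs
  have e1 : Real.exp a = Real.exp (a / 2) * Real.exp (a / 2) := by
    rw [← Real.exp_add]; congr 1; ring
  have e2 : Real.exp (a / 2) * Real.exp (-(a / 2)) = 1 := by rw [← Real.exp_add]; simp
  have hx := Real.exp_pos (a / 2)
  have ha' : (0 : ℝ) < a := ha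
  -- the numerator is `(e ^ a - 1) ^ 2 - a ^ 2 e ^ a`
  have key : a * Real.exp (a / 2) < Real.exp a - 1 := by
    nlinarith [mul_lt_mul_of_pos_left hs hx]
  have key2 : a ^ 2 * Real.exp a < (Real.exp a - 1) ^ 2 := by
    have := pow_lt_pow_left₀ key (by positivity) two_ne_zero
    calc a ^ 2 * Real.exp a = (a * Real.exp (a / 2)) ^ 2 := by rw [e1]; ring
      _ < _ := this
  have e3 : Real.exp a * expRem (-a) = 1 + (a - 1) * Real.exp a := by
    unfold expRem; linear_combination h3
  have e4 : Real.exp a * ((Real.exp (-a) - 1) * (-1)) = Real.exp a - 1 := by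
    linear_combination -h3
  rw [e3, e4]
  unfold expRem
  nlinarith

theorem strictAntiOn_expRem_ratio :
    StrictAntiOn (fun a => expRem (-a) / expRem a) (Set.Ioi 0) := by
  have hd : ∀ a ∈ Set.Ioi (0 : ℝ), HasDerivAt (fun a => expRem (-a) / expRem a)
      (((Real.exp (-a) - 1) * (-1) * expRem a
        - expRem (-a) * (Real.exp a - 1)) / expRem a ^ 2) a := fun a ha =>
    ((hasDerivAt_expRem (-a)).comp a (hasDerivAt_neg a)).div
      (hasDerivAt_expRem a) (expRem_pos (ne_of_gt ha)).ne'
  refine strictAntiOn_of_deriv_neg (convex_Ioi 0)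
    (fun x hx => (hd x hx).continuousAt.continuousWithinAt) fun a ha => ?_
  rw [interior_Ioi] at ha
  rw [(hd a ha).deriv]
  refine div_neg_of_neg_of_pos ?_ (pow_pos (expRem_pos (ne_of_gt ha)) 2)
  have h3 : Real.exp a * Real.exp (-a) = 1 := by rw [← Real.exp_add]; simp
  have h1 : (Real.exp (-a) - 1) * (-1) = Real.exp (-a) * (Real.exp a - 1) := by
    linear_combination -h3
  have h4 := expRem_lt_exp_mul ha
  have h5 : Real.exp (-a) * expRem a < expRem (-a) := by
    have := mul_lt_mul_of_pos_left h4 (Real.exp_pos (-a))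
    rwa [← mul_assoc, mul_comm (Real.exp (-a)) (Real.exp a), h3, one_mul] at this
  have h6 : 0 < Real.exp a - 1 := sub_pos.2 (Real.one_lt_exp_iff.2 ha)
  rw [h1]
  nlinarith [mul_lt_mul_of_pos_right h5 h6]

/-- The ratio whose comparison with `l / k` decides whether the curve of the two-level vectors
with multiplicities `k` and `l` is locally concave or convex; see `hasDerivAt_levelSlope`. -/
noncomputable def curvRatio (α L : ℝ) : ℝ :=
  Real.exp L * expRem ((α - 1) * L) / expRem ((1 - α) * L)

theorem strictMonoOn_curvRatio {α : ℝ} (hα0 : 0 < α) (hα1 : α ≠ 1) :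
    StrictMonoOn (curvRatio α) (Set.Ioi 0) := by
  intro L hL M hM hLM
  have hL' : (0 : ℝ) < L := hL
  have hM' : (0 : ℝ) < M := hM
  rcases lt_or_gt_of_ne hα1 with h | h
  · have h1 : 0 < 1 - α := sub_pos.2 h
    have hr := strictMonoOn_exp_mul_expRem_ratio (mul_pos h1 hL') (mul_pos h1 hM')
      (mul_lt_mul_of_pos_left hLM h1)
    have e : ∀ x, curvRatio α x = Real.exp (α * x) *
        (Real.exp ((1 - α) * x) * expRem (-((1 - α) * x)) / expRem ((1 - α) * x)) := by
      intro x
      have : Real.exp x = Real.exp (α * x) * Real.exp ((1 - α) * x) := by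
        rw [← Real.exp_add]; congr 1; ring
      rw [curvRatio, this, show (α - 1) * x = -((1 - α) * x) by ring]; ring
    rw [e, e]
    refine mul_lt_mul (Real.exp_lt_exp.2 (mul_lt_mul_of_pos_left hLM hα0)) hr.le ?_
      (Real.exp_pos _).le
    exact div_pos (mul_pos (Real.exp_pos _) (expRem_pos (neg_ne_zero.2 (mul_pos h1 hL').ne')))
      (expRem_pos (mul_pos h1 hL').ne')
  · have h1 : 0 < α - 1 := sub_pos.2 h
    have hr := strictAntiOn_expRem_ratio (mul_pos h1 hL') (mul_pos h1 hM')
      (mul_lt_mul_of_pos_left hLM h1)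
    have e : ∀ x, curvRatio α x = Real.exp x *
        (expRem (-((α - 1) * x)) / expRem ((α - 1) * x))⁻¹ := by
      intro x
      rw [curvRatio, show (1 - α) * x = -((α - 1) * x) by ring, inv_div, mul_div_assoc]
    have hp : ∀ x, 0 < x → 0 < expRem (-((α - 1) * x)) / expRem ((α - 1) * x) := fun x hx =>
      div_pos (expRem_pos (neg_ne_zero.2 (mul_pos h1 hx).ne')) (expRem_pos (mul_pos h1 hx).ne')
    rw [e, e]
    refine mul_lt_mul (Real.exp_lt_exp.2 hLM) ?_ (inv_pos.2 (hp L hL')) (Real.exp_pos _).le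
    exact (inv_le_inv₀ (hp L hL') (hp M hM')).2 hr.le

theorem curvRatio_bounds {α L : ℝ} (hα1 : α ≠ 1) (hL : 0 < L) :
    Real.exp (min 1 α * L) < curvRatio α L ∧ curvRatio α L < Real.exp (max 1 α * L) := by
  rcases lt_or_gt_of_ne hα1 with h | h
  · have ha : 0 < (1 - α) * L := mul_pos (sub_pos.2 h) hL
    have hp := expRem_pos ha.ne'
    have h1 := expRem_neg_lt ha
    have h2 := expRem_lt_exp_mul ha
    rw [min_eq_right h.le, max_eq_left h.le, curvRatio, lt_div_iff₀ hp, div_lt_iff₀ hp, one_mul,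
      show (α - 1) * L = -((1 - α) * L) by ring]
    refine ⟨?_, mul_lt_mul_of_pos_left h1 (Real.exp_pos _)⟩
    have : Real.exp L = Real.exp (α * L) * Real.exp ((1 - α) * L) := by
      rw [← Real.exp_add]; congr 1; ring
    rw [this, mul_assoc]
    exact mul_lt_mul_of_pos_left h2 (Real.exp_pos _)
  · have ha : 0 < (α - 1) * L := mul_pos (sub_pos.2 h) hL
    have h1 := expRem_neg_lt ha
    have h2 := expRem_lt_exp_mul ha
    have hp := expRem_pos (neg_ne_zero.2 ha.ne')
    rw [min_eq_left h.le, max_eq_right h.le, curvRatio, one_mul,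
      show (1 - α) * L = -((α - 1) * L) by ring, lt_div_iff₀ hp, div_lt_iff₀ hp]
    refine ⟨mul_lt_mul_of_pos_left h1 (Real.exp_pos _), ?_⟩
    have : Real.exp (α * L) = Real.exp L * Real.exp ((α - 1) * L) := by
      rw [← Real.exp_add]; congr 1; ring
    rw [this, mul_assoc]
    exact mul_lt_mul_of_pos_left h2 (Real.exp_pos _)

/-- The slope `d‖·‖_α / dH` along the probability vectors with `k` entries `y` and `l` entries
`t < y`, as a function of `L = log (y / t)`. The multiplicities may be any positive reals. -/
noncomputable def levelSlope (k l α L : ℝ) : ℝ :=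
  -((k * Real.exp (α * L) + l) ^ (1 / α - 1) * (Real.exp ((α - 1) * L) - 1) / L)

/-- The sign of the derivative of the slope is that of `curvRatio α L - l / k`. -/
theorem hasDerivAt_levelSlope {k l α L : ℝ} (hk : 0 < k) (hl : 0 < l) (hα0 : 0 < α) (hL : 0 < L) :
    HasDerivAt (levelSlope k l α)
      ((k * Real.exp (α * L) + l) ^ (1 / α - 2) * Real.exp ((α - 1) * L) / L ^ 2 *
        (k * Real.exp L * expRem ((α - 1) * L) - l * expRem ((1 - α) * L))) L := by
  have hW : 0 < k * Real.exp (α * L) + l := by positivity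
  have hE : ∀ c : ℝ, HasDerivAt (fun L => Real.exp (c * L)) (Real.exp (c * L) * (c * 1)) L :=
    fun c => ((hasDerivAt_id L).const_mul c).exp
  have h := (((((((hE α).const_mul k).add_const l).rpow_const (p := 1 / α - 1)
    (Or.inl hW.ne'))).mul ((hE (α - 1)).sub_const 1)).div (hasDerivAt_id L) hL.ne').neg
  refine h.congr_deriv ?_
  have e1 : (k * Real.exp (α * L) + l) ^ (1 / α - 1) =
      (k * Real.exp (α * L) + l) ^ (1 / α - 2) * (k * Real.exp (α * L) + l) := by
    rw [← Real.rpow_add_one hW.ne']; congr 1; ring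
  have e2 : Real.exp (α * L) = Real.exp L * Real.exp ((α - 1) * L) := by
    rw [← Real.exp_add]; congr 1; ring
  have e3 : Real.exp ((1 - α) * L) = (Real.exp ((α - 1) * L))⁻¹ := by
    rw [← Real.exp_neg]; congr 1; ring
  rw [show (1 / α - 1 - 1 : ℝ) = 1 / α - 2 by ring]
  unfold expRem
  simp only [id, Pi.mul_apply]
  rw [e1, e3]
  generalize (k * Real.exp (α * L) + l) ^ (1 / α - 2) = V
  rw [e2]
  have hx := (Real.exp_pos ((α - 1) * L)).ne'
  generalize Real.exp ((α - 1) * L) = x at *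
  generalize Real.exp L = z
  field_simp
  ring

/-- Since `curvRatio` exceeds `1`, the slope is monotone when `l ≤ k`; as the entropy decreases
in `L`, the curve is then concave. -/
theorem levelSlope_strictMonoOn {k l α : ℝ} (hl : 0 < l) (hlk : l ≤ k) (hα0 : 0 < α)
    (hα1 : α ≠ 1) : StrictMonoOn (levelSlope k l α) (Set.Ioi 0) := by
  have hk := hl.trans_le hlk
  refine strictMonoOn_of_deriv_pos (convex_Ioi 0) (fun L hL =>
    (hasDerivAt_levelSlope hk hl hα0 hL).continuousAt.continuousWithinAt) fun L hL => ?_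
  rw [interior_Ioi] at hL
  have hL' : (0 : ℝ) < L := hL
  rw [(hasDerivAt_levelSlope hk hl hα0 hL).deriv]
  have hq : 0 < expRem ((1 - α) * L) :=
    expRem_pos (mul_ne_zero (sub_ne_zero.2 hα1.symm) hL'.ne')
  have h1 : 1 < curvRatio α L := by
    refine lt_of_le_of_lt ?_ (curvRatio_bounds hα1 hL').1
    exact Real.one_le_exp (mul_nonneg (le_min zero_le_one hα0.le) hL'.le)
  rw [curvRatio, lt_div_iff₀ hq] at h1
  refine mul_pos (by positivity) ?_
  nlinarith [mul_le_mul_of_nonneg_right hlk hq.le]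

/-- For `k < l` the ratio `curvRatio` passes `l / k` exactly once, between the two points where
the exponential bounds of `curvRatio_bounds` do. -/
theorem levelSlope_exists_turning {k l α : ℝ} (hk : 0 < k) (hkl : k < l) (hα0 : 0 < α)
    (hα1 : α ≠ 1) : ∃ M, 0 < M ∧ StrictAntiOn (levelSlope k l α) (Set.Ioc 0 M) ∧
      StrictMonoOn (levelSlope k l α) (Set.Ici M) := by
  have hl := hk.trans hkl
  have hr : 0 < Real.log (l / k) := Real.log_pos ((one_lt_div hk).2 hkl)
  have hmin : 0 < min 1 α := lt_min one_pos hα0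
  have hmax : 0 < max 1 α := lt_max_of_lt_left one_pos
  have hne : ∀ L : ℝ, 0 < L → 0 < expRem ((1 - α) * L) := fun L hL =>
    expRem_pos (mul_ne_zero (sub_ne_zero.2 hα1.symm) hL.ne')
  have hcont : ContinuousOn (curvRatio α) (Set.Ioi 0) := by
    have hc : Continuous expRem :=
      continuous_iff_continuousAt.2 fun q => (hasDerivAt_expRem q).continuousAt
    exact ContinuousOn.div (by fun_prop) (by fun_prop) fun L hL => (hne L hL).ne'
  obtain ⟨M, hM, hMe⟩ : ∃ M ∈ Set.Icc (Real.log (l / k) / max 1 α) (Real.log (l / k) / min 1 α),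
      curvRatio α M = l / k := by
    have hle : Real.log (l / k) / max 1 α ≤ Real.log (l / k) / min 1 α :=
      div_le_div_of_nonneg_left hr.le hmin min_le_max
    refine intermediate_value_Icc hle (hcont.mono fun L hL => ?_) ⟨?_, ?_⟩
    · exact lt_of_lt_of_le (div_pos hr hmax) hL.1
    · have := (curvRatio_bounds hα1 (div_pos hr hmax)).2
      rw [mul_div_cancel₀ _ hmax.ne', Real.exp_log (div_pos hl hk)] at this
      exact this.le
    · have := (curvRatio_bounds hα1 (div_pos hr hmin)).1
      rw [mul_div_cancel₀ _ hmin.ne', Real.exp_log (div_pos hl hk)] at this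
      exact this.le
  have hM0 : 0 < M := lt_of_lt_of_le (div_pos hr hmax) hM.1
  have hmono := strictMonoOn_curvRatio hα0 hα1
  refine ⟨M, hM0, ?_, ?_⟩
  · refine strictAntiOn_of_deriv_neg (convex_Ioc 0 M) (fun L hL =>
      (hasDerivAt_levelSlope hk hl hα0 hL.1).continuousAt.continuousWithinAt) fun L hL => ?_
    rw [interior_Ioc] at hL
    rw [(hasDerivAt_levelSlope hk hl hα0 hL.1).deriv]
    have h1 : curvRatio α L < l / k := hMe ▸ hmono hL.1 hM0 hL.2
    have hL0 := hL.1
    rw [curvRatio, div_lt_div_iff₀ (hne L hL0) hk] at h1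
    exact mul_neg_of_pos_of_neg (by positivity) (by linarith)
  · refine strictMonoOn_of_deriv_pos (convex_Ici M) (fun L hL =>
      (hasDerivAt_levelSlope hk hl hα0 (hM0.trans_le hL)).continuousAt.continuousWithinAt)
      fun L hL => ?_
    rw [interior_Ici] at hL
    have hL0 : 0 < L := hM0.trans hL
    rw [(hasDerivAt_levelSlope hk hl hα0 hL0).deriv]
    have h1 : l / k < curvRatio α L := hMe ▸ hmono hM0 hL0 hL
    rw [curvRatio, div_lt_div_iff₀ hk (hne L hL0)] at h1
    exact mul_pos (by positivity) (by linarith)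

theorem levelSlope_mul_pos {k l α L : ℝ} (hk : 0 < k) (hl : 0 < l) (hα1 : α ≠ 1) (hL : 0 < L) :
    0 < levelSlope k l α L * (1 - α) := by
  have hW : 0 < (k * Real.exp (α * L) + l) ^ (1 / α - 1) := by positivity
  have key : 0 < (Real.exp ((α - 1) * L) - 1) * (α - 1) := by
    rcases lt_or_gt_of_ne hα1 with h | h
    · refine mul_pos_of_neg_of_neg (sub_neg.2 (Real.exp_lt_one_iff.2 ?_)) (by linarith)
      exact mul_neg_of_neg_of_pos (by linarith) hL
    · exact mul_pos (sub_pos.2 (Real.one_lt_exp_iff.2 (mul_pos (by linarith) hL))) (by linarith)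
  have : levelSlope k l α L * (1 - α) =
      (k * Real.exp (α * L) + l) ^ (1 / α - 1) * ((Real.exp ((α - 1) * L) - 1) * (α - 1)) / L := by
    unfold levelSlope; ring
  rw [this]
  positivity

/-! ### The curve of the two-level vectors and its tangents -/

/-- The value `y` for which `k` entries `y` and `l` entries `t` sum to one. -/
noncomputable def levelTop (k l t : ℝ) : ℝ := (1 - l * t) / k

/-- The `ℓ_α`-norm of the probability vector with `l` entries `t` and `k` entries
`levelTop k l t`. -/
noncomputable def levelNorm (k l α t : ℝ) : ℝ :=
  (k * levelTop k l t ^ α + l * t ^ α) ^ (1 / α)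

/-- The entropy of the probability vector with `l` entries `t` and `k` entries
`levelTop k l t`. -/
noncomputable def levelEntropy (k l t : ℝ) : ℝ :=
  k * Real.negMulLog (levelTop k l t) + l * Real.negMulLog t

/-- The slope `d‖·‖_α / dH` of the curve of two-level vectors at the parameter `t`. -/
noncomputable def levelSlopeAt (k l α t : ℝ) : ℝ :=
  levelSlope k l α (Real.log (levelTop k l t / t))

section LevelCurve

variable {k l α : ℝ}

theorem lt_levelTop (hk : 0 < k) (hl : 0 < l) {t : ℝ} (ht : t < 1 / (k + l)) :
    t < levelTop k l t := by
  rw [lt_div_iff₀ (by positivity)] at ht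
  rw [levelTop, lt_div_iff₀ hk]
  linarith

theorem levelTop_end (hk : 0 < k) (hl : 0 < l) : levelTop k l (1 / (k + l)) = 1 / (k + l) := by
  rw [levelTop]; field_simp; ring

theorem hasDerivAt_levelTop (t : ℝ) : HasDerivAt (levelTop k l) (-l / k) t := by
  have h := (((hasDerivAt_id t).const_mul l).const_sub 1).div_const k
  rw [mul_one] at h
  exact h

theorem continuous_levelEntropy : Continuous (levelEntropy k l) := by
  have h : Continuous (levelTop k l) :=
    continuous_iff_continuousAt.2 fun t => (hasDerivAt_levelTop t).continuousAt
  have := Real.continuous_negMulLog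
  unfold levelEntropy
  fun_prop

theorem continuous_levelNorm (hα0 : 0 < α) : Continuous (levelNorm k l α) := by
  have h : Continuous (levelTop k l) :=
    continuous_iff_continuousAt.2 fun t => (hasDerivAt_levelTop t).continuousAt
  have h1 := h.rpow_const (p := α) fun _ => Or.inr hα0.le
  have h2 := continuous_id.rpow_const (p := α) fun _ => Or.inr hα0.le
  exact ((h1.const_mul k).add (h2.const_mul l)).rpow_const fun _ => Or.inr (by positivity)

theorem log_levelTop_div_pos (hk : 0 < k) (hl : 0 < l) {t : ℝ}
    (ht : t ∈ Set.Ioo 0 (1 / (k + l))) : 0 < Real.log (levelTop k l t / t) :=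
  Real.log_pos ((one_lt_div ht.1).2 (lt_levelTop hk hl ht.2))

theorem log_levelTop_div_strictAntiOn (hk : 0 < k) (hl : 0 < l) :
    StrictAntiOn (fun t => Real.log (levelTop k l t / t)) (Set.Ioo 0 (1 / (k + l))) := by
  intro a ha b hb hab
  have hb' := lt_levelTop hk hl hb.2
  refine Real.log_lt_log (div_pos (hb.1.trans hb') hb.1) ?_
  rw [div_lt_div_iff₀ hb.1 ha.1]
  have : levelTop k l b < levelTop k l a := by
    rw [levelTop, levelTop]
    exact div_lt_div_of_pos_right (by nlinarith) hk
  have ha0 := ha.1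
  have hb0 := hb.1
  nlinarith

theorem hasDerivAt_levelEntropy (hk : 0 < k) (hl : 0 < l) {t : ℝ}
    (ht : t ∈ Set.Ioo 0 (1 / (k + l))) :
    HasDerivAt (levelEntropy k l) (l * Real.log (levelTop k l t / t)) t := by
  have hy := ht.1.trans (lt_levelTop hk hl ht.2)
  have h := (((Real.hasDerivAt_negMulLog hy.ne').comp t (hasDerivAt_levelTop t)).const_mul k).add
    ((Real.hasDerivAt_negMulLog ht.1.ne').const_mul l)
  refine h.congr_deriv ?_
  rw [Real.log_div hy.ne' ht.1.ne']
  field_simp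
  ring

theorem hasDerivAt_levelNorm (hk : 0 < k) (hl : 0 < l) (hα0 : 0 < α) {t : ℝ}
    (ht : t ∈ Set.Ioo 0 (1 / (k + l))) :
    HasDerivAt (levelNorm k l α)
      (levelSlopeAt k l α t * (l * Real.log (levelTop k l t / t))) t := by
  have ht0 := ht.1
  have hL := log_levelTop_div_pos hk hl ht
  have hy := ht.1.trans (lt_levelTop hk hl ht.2)
  have hW : 0 < k * levelTop k l t ^ α + l * t ^ α := by positivity
  have h := ((((hasDerivAt_levelTop (k := k) (l := l) t).rpow_const (p := α)
    (Or.inl hy.ne')).const_mul k).add (((hasDerivAt_id t).rpow_const (p := α)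
    (Or.inl ht0.ne')).const_mul l)).rpow_const (p := 1 / α) (Or.inl hW.ne')
  refine h.congr_deriv ?_
  simp only [id, Pi.add_apply]
  have hz : 0 < levelTop k l t / t := div_pos hy ht0
  have e1 : ∀ c : ℝ, Real.exp (c * Real.log (levelTop k l t / t)) = levelTop k l t ^ c / t ^ c := by
    intro c
    rw [mul_comm, ← Real.rpow_def_of_pos hz, Real.div_rpow hy.le ht0.le]
  have e2 : (k * levelTop k l t ^ α + l * t ^ α) ^ (1 / α - 1) =
      t ^ (1 - α) * (k * (levelTop k l t ^ α / t ^ α) + l) ^ (1 / α - 1) := by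
    have : k * levelTop k l t ^ α + l * t ^ α =
        t ^ α * (k * (levelTop k l t ^ α / t ^ α) + l) := by
      field_simp
    rw [this, Real.mul_rpow (by positivity) (by positivity), ← Real.rpow_mul ht0.le]
    congr 2
    field_simp
  have e3 : t ^ (1 - α) = (t ^ (α - 1))⁻¹ := by
    rw [← Real.rpow_neg ht0.le]; congr 1; ring
  rw [levelSlopeAt, levelSlope, e1, e1, e2, e3]
  have ht1 : 0 < t ^ (α - 1) := by positivity
  generalize (k * (levelTop k l t ^ α / t ^ α) + l) ^ (1 / α - 1) = V
  field_simp
  ring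

/-- The mean value theorem along the curve: the increment of `‖·‖_α - c H` between two parameters
has the sign of `slope - c` at some intermediate parameter. -/
theorem levelCurve_mean_value (hk : 0 < k) (hl : 0 < l) (hα0 : 0 < α) (c : ℝ) {a b : ℝ}
    (ha : 0 ≤ a) (hab : a < b) (hb : b ≤ 1 / (k + l)) :
    ∃ x ∈ Set.Ioo a b, ∃ r > 0, (levelNorm k l α b - c * levelEntropy k l b) -
      (levelNorm k l α a - c * levelEntropy k l a) = (levelSlopeAt k l α x - c) * r := by
  have hmem : ∀ x ∈ Set.Ioo a b, x ∈ Set.Ioo 0 (1 / (k + l)) := fun x hx =>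
    ⟨ha.trans_lt hx.1, hx.2.trans_le hb⟩
  obtain ⟨x, hx, he⟩ := exists_hasDerivAt_eq_slope
    (fun t => levelNorm k l α t - c * levelEntropy k l t) _ hab
    ((continuous_levelNorm hα0).sub (continuous_levelEntropy.const_mul c)).continuousOn
    fun x hx => (hasDerivAt_levelNorm hk hl hα0 (hmem x hx)).sub
      ((hasDerivAt_levelEntropy hk hl (hmem x hx)).const_mul c)
  have hL := log_levelTop_div_pos hk hl (hmem x hx)
  refine ⟨x, hx, l * Real.log (levelTop k l x / x) * (b - a), by
    have := sub_pos.2 hab; positivity, ?_⟩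
  rw [eq_div_iff (sub_pos.2 hab).ne'] at he
  linear_combination -he

theorem levelEntropy_strictMonoOn (hk : 0 < k) (hl : 0 < l) :
    StrictMonoOn (levelEntropy k l) (Set.Icc 0 (1 / (k + l))) := by
  refine strictMonoOn_of_deriv_pos (convex_Icc _ _) continuous_levelEntropy.continuousOn
    fun t ht => ?_
  rw [interior_Icc] at ht
  rw [(hasDerivAt_levelEntropy hk hl ht).deriv]
  exact mul_pos hl (log_levelTop_div_pos hk hl ht)

theorem levelSlopeAt_strictAntiOn (hl : 0 < l) (hlk : l ≤ k) (hα0 : 0 < α) (hα1 : α ≠ 1) :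
    StrictAntiOn (levelSlopeAt k l α) (Set.Ioo 0 (1 / (k + l))) := by
  have hk := hl.trans_le hlk
  intro a ha b hb hab
  exact levelSlope_strictMonoOn hl hlk hα0 hα1 (log_levelTop_div_pos hk hl hb)
    (log_levelTop_div_pos hk hl ha) (log_levelTop_div_strictAntiOn hk hl ha hb hab)

/-- Where the curve is concave, it lies above its chord. -/
theorem levelCurve_chord (hl : 0 < l) (hlk : l ≤ k) (hα0 : 0 < α) (hα1 : α ≠ 1) {b C : ℝ}
    (h0 : C ≤ levelNorm k l α 0 - b * levelEntropy k l 0)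
    (h1 : C ≤ levelNorm k l α (1 / (k + l)) - b * levelEntropy k l (1 / (k + l))) {t : ℝ}
    (ht : t ∈ Set.Icc 0 (1 / (k + l))) :
    C ≤ levelNorm k l α t - b * levelEntropy k l t := by
  have hk := hl.trans_le hlk
  by_contra! hlt
  have ht0 : 0 < t := by
    rcases ht.1.eq_or_lt with h | h
    · rw [← h] at hlt; linarith
    · exact h
  have ht1 : t < 1 / (k + l) := by
    rcases ht.2.eq_or_lt with h | h
    · rw [h] at hlt; linarith
    · exact h
  obtain ⟨x, hx, r, hr, hxe⟩ := levelCurve_mean_value hk hl hα0 b le_rfl ht0 ht1.le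
  obtain ⟨x', hx', r', hr', hxe'⟩ := levelCurve_mean_value hk hl hα0 b ht0.le ht1 le_rfl
  have hs := levelSlopeAt_strictAntiOn hl hlk hα0 hα1 ⟨hx.1, hx.2.trans ht1⟩
    ⟨ht0.trans hx'.1, hx'.2⟩ (hx.2.trans hx'.1)
  have i1 : levelSlopeAt k l α x - b < 0 := by
    by_contra! h; have := mul_nonneg h hr.le; linarith
  have i2 : 0 < levelSlopeAt k l α x' - b := by
    by_contra! h; have := mul_nonpos_of_nonpos_of_nonneg h hr'.le; linarith
  linarith

/-- Where the curve is concave, it lies below its tangents. -/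
theorem levelCurve_le_tangent (hl : 0 < l) (hlk : l ≤ k) (hα0 : 0 < α) (hα1 : α ≠ 1) {t₀ t : ℝ}
    (ht₀ : t₀ ∈ Set.Ioo 0 (1 / (k + l))) (ht : t ∈ Set.Icc 0 (1 / (k + l))) :
    levelNorm k l α t - levelSlopeAt k l α t₀ * levelEntropy k l t ≤
      levelNorm k l α t₀ - levelSlopeAt k l α t₀ * levelEntropy k l t₀ := by
  have hk := hl.trans_le hlk
  rcases lt_trichotomy t t₀ with h | h | h
  · obtain ⟨x, hx, r, hr, hxe⟩ := levelCurve_mean_value hk hl hα0 (levelSlopeAt k l α t₀) ht.1 h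
      ht₀.2.le
    have hs := levelSlopeAt_strictAntiOn hl hlk hα0 hα1 ⟨ht.1.trans_lt hx.1, hx.2.trans ht₀.2⟩
      ht₀ hx.2
    have := mul_pos (sub_pos.2 hs) hr
    linarith
  · rw [h]
  · obtain ⟨x, hx, r, hr, hxe⟩ := levelCurve_mean_value hk hl hα0 (levelSlopeAt k l α t₀) ht₀.1.le h
      ht.2
    have hs := levelSlopeAt_strictAntiOn hl hlk hα0 hα1 ht₀ ⟨ht₀.1.trans hx.1, hx.2.trans_le ht.2⟩
      hx.1
    have := mul_neg_of_neg_of_pos (sub_neg.2 hs) hr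
    linarith

theorem levelSlopeAt_exists_turning (hk : 0 < k) (hkl : k < l) (hα0 : 0 < α) (hα1 : α ≠ 1) :
    ∃ c ∈ Set.Ioo 0 (1 / (k + l)), StrictAntiOn (levelSlopeAt k l α) (Set.Ioc 0 c) ∧
      StrictMonoOn (levelSlopeAt k l α) (Set.Ico c (1 / (k + l))) := by
  have hl := hk.trans hkl
  obtain ⟨M, hM, hanti, hmono⟩ := levelSlope_exists_turning hk hkl hα0 hα1
  have hM1 : 1 < Real.exp M := Real.one_lt_exp_iff.2 hM
  have hc0 : 0 < 1 / (k * Real.exp M + l) := by positivity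
  have hc1 : 1 / (k * Real.exp M + l) < 1 / (k + l) :=
    one_div_lt_one_div_of_lt (by positivity) (by nlinarith)
  have hcM :
      Real.log (levelTop k l (1 / (k * Real.exp M + l)) / (1 / (k * Real.exp M + l))) = M := by
    have : levelTop k l (1 / (k * Real.exp M + l)) / (1 / (k * Real.exp M + l)) = Real.exp M := by
      rw [levelTop]; field_simp; ring
    rw [this, Real.log_exp]
  have hlog := log_levelTop_div_strictAntiOn hk hl
  refine ⟨_, ⟨hc0, hc1⟩, fun a ha b hb hab => ?_, fun a ha b hb hab => ?_⟩
  · have ha' : a ∈ Set.Ioo 0 (1 / (k + l)) := ⟨ha.1, ha.2.trans_lt hc1⟩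
    have hb' : b ∈ Set.Ioo 0 (1 / (k + l)) := ⟨hb.1, hb.2.trans_lt hc1⟩
    refine hmono ?_ ?_ (hlog ha' hb' hab)
    · exact hcM.symm.trans_le (hlog.antitoneOn hb' ⟨hc0, hc1⟩ hb.2)
    · exact hcM.symm.trans_le (hlog.antitoneOn ha' ⟨hc0, hc1⟩ ha.2)
  · have ha' : a ∈ Set.Ioo 0 (1 / (k + l)) := ⟨hc0.trans_le ha.1, ha.2⟩
    have hb' : b ∈ Set.Ioo 0 (1 / (k + l)) := ⟨hc0.trans_le hb.1, hb.2⟩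
    refine hanti ⟨log_levelTop_div_pos hk hl hb', ?_⟩ ⟨log_levelTop_div_pos hk hl ha', ?_⟩
      (hlog ha' hb' hab)
    · exact (hlog.antitoneOn ⟨hc0, hc1⟩ hb' hb.1).trans_eq hcM
    · exact (hlog.antitoneOn ⟨hc0, hc1⟩ ha' ha.1).trans_eq hcM

/-- The height at the last point `t = 1 / (k + l)` (the uniform vector) of the curve above its
tangent at `t`. The tangency equation says that it vanishes. -/
noncomputable def tangencyGap (k l α t : ℝ) : ℝ :=
  levelNorm k l α (1 / (k + l)) - levelNorm k l α t -
    (levelEntropy k l (1 / (k + l)) - levelEntropy k l t) * levelSlopeAt k l α t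

theorem continuousOn_levelSlopeAt (hk : 0 < k) (hl : 0 < l) (hα0 : 0 < α) :
    ContinuousOn (levelSlopeAt k l α) (Set.Ioo 0 (1 / (k + l))) := by
  intro t ht
  have hy := ht.1.trans (lt_levelTop hk hl ht.2)
  have h1 : ContinuousAt (fun t => Real.log (levelTop k l t / t)) t :=
    (((hasDerivAt_levelTop t).continuousAt).div continuousAt_id ht.1.ne').log
      (div_pos hy ht.1).ne'
  exact (ContinuousAt.comp (f := fun t => Real.log (levelTop k l t / t)) (g := levelSlope k l α)
    (hasDerivAt_levelSlope hk hl hα0 (log_levelTop_div_pos hk hl ht)).continuousAt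
    h1).continuousWithinAt

theorem levelNorm_one_zero (hα0 : 0 < α) : levelNorm 1 l α 0 = 1 := by
  simp [levelNorm, levelTop, hα0.ne']

theorem levelEntropy_one_zero : levelEntropy 1 l 0 = 0 := by
  simp [levelEntropy, levelTop]

theorem levelEntropy_end (hk : 0 < k) (hl : 0 < l) :
    levelEntropy k l (1 / (k + l)) = Real.log (k + l) := by
  rw [levelEntropy, levelTop_end hk hl, Real.negMulLog, one_div, Real.log_inv]
  field_simp

theorem levelNorm_end (hk : 0 < k) (hl : 0 < l) (hα0 : 0 < α) :
    levelNorm k l α (1 / (k + l)) = (k + l) ^ (1 / α - 1) := by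
  have h : 0 < k + l := by positivity
  have e : (k + l) * (k + l) ^ (-α) = (k + l) ^ (1 - α) := by
    rw [sub_eq_add_neg, Real.rpow_add h, Real.rpow_one]
  rw [levelNorm, levelTop_end hk hl, ← add_mul, one_div, Real.inv_rpow h.le,
    ← Real.rpow_neg h.le, e, ← Real.rpow_mul h.le]
  congr 1
  field_simp

theorem tendsto_log_levelTop_div :
    Filter.Tendsto (fun t => Real.log (levelTop 1 l t / t)) (nhdsWithin 0 (Set.Ioi 0))
      Filter.atTop := by
  refine Real.tendsto_log_atTop.comp ?_
  have h1 : Filter.Tendsto (levelTop 1 l) (nhdsWithin 0 (Set.Ioi 0)) (nhds 1) := by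
    have := (hasDerivAt_levelTop (k := 1) (l := l) 0).continuousAt.tendsto.mono_left
      (nhdsWithin_le_nhds (s := Set.Ioi 0))
    simpa [levelTop] using this
  exact h1.pos_mul_atTop one_pos tendsto_inv_nhdsGT_zero

/-- Near the deterministic vector the slope tends to `+∞` for `α < 1` and to `0` for `α > 1`, where
the curve drops from `1`; in both cases the tangent there ends above the uniform vector. -/
theorem exists_tangencyGap_neg (hl : 0 < l) (hα0 : 0 < α) (hα1 : α ≠ 1) {c : ℝ} (hc : 0 < c) :
    ∃ t ∈ Set.Ioo 0 c, tangencyGap 1 l α t < 0 := by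
  have hlog := tendsto_log_levelTop_div (l := l)
  have hN : Filter.Tendsto (levelNorm 1 l α) (nhdsWithin 0 (Set.Ioi 0)) (nhds 1) := by
    have := ((continuous_levelNorm (k := 1) (l := l) hα0).tendsto 0).mono_left
      (nhdsWithin_le_nhds (s := Set.Ioi 0))
    rwa [levelNorm_one_zero hα0] at this
  have hH : Filter.Tendsto (levelEntropy 1 l) (nhdsWithin 0 (Set.Ioi 0)) (nhds 0) := by
    have := ((continuous_levelEntropy (k := 1) (l := l)).tendsto 0).mono_left
      (nhdsWithin_le_nhds (s := Set.Ioi 0))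
    rwa [levelEntropy_one_zero] at this
  have he : 0 < 1 / (1 + l) := by positivity
  have hmem : ∀ᶠ t in nhdsWithin 0 (Set.Ioi 0), t ∈ Set.Ioo 0 (min c (1 / (1 + l))) :=
    Ioo_mem_nhdsGT (lt_min hc he)
  have hHe : 0 < levelEntropy 1 l (1 / (1 + l)) := by
    rw [levelEntropy_end one_pos hl]; exact Real.log_pos (by linarith)
  suffices h : ∀ᶠ t in nhdsWithin 0 (Set.Ioi 0), tangencyGap 1 l α t < 0 by
    obtain ⟨t, ht, ht'⟩ := (h.and hmem).exists
    exact ⟨t, ⟨ht'.1, ht'.2.trans_le (min_le_left _ _)⟩, ht⟩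
  have hWle : ∀ L : ℝ, Real.exp (α * L) ^ (1 / α - 1) = Real.exp ((1 - α) * L) := by
    intro L
    rw [← Real.exp_mul]; congr 1; field_simp
  rcases lt_or_gt_of_ne hα1 with h | h
  · have ha : 0 < 1 - α := by linarith
    have hγ : 0 ≤ 1 / α - 1 := by
      rw [sub_nonneg, le_div_iff₀ hα0]; linarith
    have hs : ∀ L, 0 < L → (1 - α) ^ 2 / 2 * L ≤ levelSlope 1 l α L := by
      intro L hL
      have h1 := Real.quadratic_le_exp_of_nonneg (mul_pos ha hL).le
      have h2 : Real.exp ((1 - α) * L) ≤ (1 * Real.exp (α * L) + l) ^ (1 / α - 1) := by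
        rw [← hWle]
        exact Real.rpow_le_rpow (Real.exp_pos _).le (by linarith) hγ
      have h3 : Real.exp ((α - 1) * L) < 1 :=
        Real.exp_lt_one_iff.2 (mul_neg_of_neg_of_pos (by linarith) hL)
      have h4 : Real.exp ((1 - α) * L) * Real.exp ((α - 1) * L) = 1 := by
        rw [← Real.exp_add, ← Real.exp_zero]; congr 1; ring
      rw [levelSlope, ← neg_div, le_div_iff₀ hL]
      nlinarith [mul_le_mul_of_nonneg_right h2 (sub_pos.2 h3).le, mul_pos ha hL]
    have hbig := hlog.eventually_gt_atTop
      (levelNorm 1 l α (1 / (1 + l)) / (levelEntropy 1 l (1 / (1 + l)) / 2 * ((1 - α) ^ 2 / 2)))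
    filter_upwards [hmem, hbig, hN.eventually (lt_mem_nhds one_pos),
      hH.eventually (gt_mem_nhds (half_pos hHe))] with t ht hL hNt hHt
    have ht' : t ∈ Set.Ioo 0 (1 / (1 + l)) := ⟨ht.1, ht.2.trans_le (min_le_right _ _)⟩
    have hL0 := log_levelTop_div_pos one_pos hl ht'
    have h1 := hs _ hL0
    rw [div_lt_iff₀ (by positivity)] at hL
    have h5 : 0 < (1 - α) ^ 2 / 2 * Real.log (levelTop 1 l t / t) := by positivity
    have h6 : levelEntropy 1 l (1 / (1 + l)) / 2 *
        ((1 - α) ^ 2 / 2 * Real.log (levelTop 1 l t / t)) ≤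
        (levelEntropy 1 l (1 / (1 + l)) - levelEntropy 1 l t) * levelSlopeAt 1 l α t :=
      mul_le_mul (by linarith) h1 h5.le (by linarith)
    rw [tangencyGap]
    linarith
  · have hγ : 1 / α - 1 ≤ 0 := by
      rw [sub_nonpos, div_le_iff₀ hα0]; linarith
    have hs : ∀ L, 0 < L → -(1 / L) ≤ levelSlope 1 l α L := by
      intro L hL
      have h2 : (1 * Real.exp (α * L) + l) ^ (1 / α - 1) ≤ Real.exp ((1 - α) * L) := by
        rw [← hWle]
        exact Real.rpow_le_rpow_of_nonpos (Real.exp_pos _) (by linarith) hγ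
      have h3 : 1 < Real.exp ((α - 1) * L) :=
        Real.one_lt_exp_iff.2 (mul_pos (by linarith) hL)
      have h4 : Real.exp ((1 - α) * L) * Real.exp ((α - 1) * L) = 1 := by
        rw [← Real.exp_add, ← Real.exp_zero]; congr 1; ring
      have h5 := Real.exp_pos ((1 - α) * L)
      rw [levelSlope]
      refine neg_le_neg (div_le_div_of_nonneg_right ?_ hL.le)
      nlinarith [mul_le_mul_of_nonneg_right h2 (sub_pos.2 h3).le]
    have hNe : levelNorm 1 l α (1 / (1 + l)) < 1 := by
      rw [levelNorm_end one_pos hl hα0]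
      refine Real.rpow_lt_one_of_one_lt_of_neg (by linarith) ?_
      rw [sub_neg, div_lt_iff₀ hα0]; linarith
    have hlim : Filter.Tendsto (fun t => levelNorm 1 l α (1 / (1 + l)) - levelNorm 1 l α t +
        levelEntropy 1 l (1 / (1 + l)) * (Real.log (levelTop 1 l t / t))⁻¹)
        (nhdsWithin 0 (Set.Ioi 0)) (nhds (levelNorm 1 l α (1 / (1 + l)) - 1 +
          levelEntropy 1 l (1 / (1 + l)) * 0)) :=
      (hN.const_sub _).add ((tendsto_inv_atTop_zero.comp hlog).const_mul _)
    filter_upwards [hmem, hlim.eventually (gt_mem_nhds (show _ < (0 : ℝ) by linarith))]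
      with t ht hlt
    have ht' : t ∈ Set.Ioo 0 (1 / (1 + l)) := ⟨ht.1, ht.2.trans_le (min_le_right _ _)⟩
    have hL0 := log_levelTop_div_pos one_pos hl ht'
    have h1 := hs _ hL0
    have hmono := levelEntropy_strictMonoOn (k := 1) one_pos hl
    have hH0 : 0 ≤ levelEntropy 1 l t := by
      rw [← levelEntropy_one_zero (l := l)]
      exact hmono.monotoneOn ⟨le_rfl, he.le⟩ ⟨ht'.1.le, ht'.2.le⟩ ht'.1.le
    have hH1 : levelEntropy 1 l t < levelEntropy 1 l (1 / (1 + l)) :=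
      hmono ⟨ht'.1.le, ht'.2.le⟩ ⟨he.le, le_rfl⟩ ht'.2
    have h6 := mul_le_mul_of_nonneg_left h1 (sub_pos.2 hH1).le
    have h7 : 0 ≤ levelEntropy 1 l t * (1 / Real.log (levelTop 1 l t / t)) := by positivity
    rw [← one_div] at hlt
    rw [tangencyGap]
    unfold levelSlopeAt
    linarith

/-- For `k = 1 < l` the curve is concave and then convex, so exactly one tangent passes through
its last point; up to the point of tangency, all tangents lie above the whole curve. -/
theorem exists_unique_tangency (hl : 1 < l) (hα0 : 0 < α) (hα1 : α ≠ 1) :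
    ∃ p ∈ Set.Ioo 0 (1 / (1 + l)), tangencyGap 1 l α p = 0 ∧
      (∀ q ∈ Set.Ioo 0 (1 / (1 + l)), tangencyGap 1 l α q = 0 → q = p) ∧
      ∀ t₀ ∈ Set.Ioc 0 p, ∀ t ∈ Set.Icc 0 (1 / (1 + l)),
        levelNorm 1 l α t - levelSlopeAt 1 l α t₀ * levelEntropy 1 l t ≤
          levelNorm 1 l α t₀ - levelSlopeAt 1 l α t₀ * levelEntropy 1 l t₀ := by
  have hl0 : 0 < l := one_pos.trans hl
  obtain ⟨c, hc, hanti, hmono⟩ := levelSlopeAt_exists_turning one_pos hl hα0 hα1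
  have hH := levelEntropy_strictMonoOn (k := 1) one_pos hl0
  have he : 0 < 1 / (1 + l) := by positivity
  have hright : ∀ t ∈ Set.Ico c (1 / (1 + l)), 0 < tangencyGap 1 l α t := by
    intro t ht
    obtain ⟨x, hx, r, hr, hxe⟩ := levelCurve_mean_value one_pos hl0 hα0 (levelSlopeAt 1 l α t)
      (hc.1.le.trans ht.1) ht.2 le_rfl
    have hs := hmono ht ⟨ht.1.trans hx.1.le, hx.2⟩ hx.1
    have := mul_pos (sub_pos.2 hs) hr
    rw [tangencyGap]; linarith
  have hleft : StrictMonoOn (tangencyGap 1 l α) (Set.Ioc 0 c) := by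
    intro a ha b hb hab
    obtain ⟨x, hx, r, hr, hxe⟩ := levelCurve_mean_value one_pos hl0 hα0 (levelSlopeAt 1 l α a)
      ha.1.le hab (hb.2.trans hc.2.le)
    have hs := hanti ha ⟨ha.1.trans hx.1, hx.2.le.trans hb.2⟩ hx.1
    have h1 := mul_neg_of_neg_of_pos (sub_neg.2 hs) hr
    have hs2 := hanti ha hb hab
    have hHb : levelEntropy 1 l b < levelEntropy 1 l (1 / (1 + l)) :=
      hH ⟨hb.1.le, hb.2.trans hc.2.le⟩ ⟨he.le, le_rfl⟩ (hb.2.trans_lt hc.2)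
    have := mul_pos (sub_pos.2 hHb) (sub_pos.2 hs2)
    rw [tangencyGap, tangencyGap]; linarith
  have hcont : ContinuousOn (tangencyGap 1 l α) (Set.Ioc 0 c) := by
    have h : ContinuousOn (levelSlopeAt 1 l α) (Set.Ioc 0 c) :=
      (continuousOn_levelSlopeAt one_pos hl0 hα0).mono fun x hx => ⟨hx.1, hx.2.trans_lt hc.2⟩
    exact (continuousOn_const.sub (continuous_levelNorm hα0).continuousOn).sub
      ((continuousOn_const.sub continuous_levelEntropy.continuousOn).mul h)
  obtain ⟨a, ha, hneg⟩ := exists_tangencyGap_neg hl0 hα0 hα1 hc.1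
  obtain ⟨p, hp, hp0⟩ : ∃ p ∈ Set.Icc a c, tangencyGap 1 l α p = 0 :=
    intermediate_value_Icc ha.2.le (hcont.mono fun x hx => ⟨ha.1.trans_le hx.1, hx.2⟩)
      ⟨hneg.le, (hright c ⟨le_rfl, hc.2⟩).le⟩
  have hpc : p ∈ Set.Ioc 0 c := ⟨ha.1.trans_le hp.1, hp.2⟩
  refine ⟨p, ⟨hpc.1, hpc.2.trans_lt hc.2⟩, hp0, fun q hq hq0 => ?_, fun t₀ ht₀ t ht => ?_⟩
  · rcases le_or_gt c q with h | h
    · exact absurd hq0 (hright q ⟨h, hq.2⟩).ne'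
    · exact hleft.injOn ⟨hq.1, h.le⟩ hpc (hq0.trans hp0.symm)
  · have ht₀c : t₀ ∈ Set.Ioc 0 c := ⟨ht₀.1, ht₀.2.trans hpc.2⟩
    have hgap : tangencyGap 1 l α t₀ ≤ 0 := hp0 ▸ hleft.monotoneOn ht₀c hpc ht₀.2
    rw [tangencyGap] at hgap
    rcases lt_trichotomy t t₀ with h | h | h
    · obtain ⟨x, hx, r, hr, hxe⟩ := levelCurve_mean_value one_pos hl0 hα0 (levelSlopeAt 1 l α t₀)
        ht.1 h (ht₀c.2.trans hc.2.le)
      have hs := hanti ⟨ht.1.trans_lt hx.1, hx.2.le.trans ht₀c.2⟩ ht₀c hx.2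
      have := mul_pos (sub_pos.2 hs) hr
      linarith
    · rw [h]
    · by_contra! hlt
      have ht1 : t < 1 / (1 + l) := by
        rcases ht.2.eq_or_lt with h' | h'
        · rw [h'] at hlt; linarith
        · exact h'
      obtain ⟨x, hx, r, hr, hxe⟩ := levelCurve_mean_value one_pos hl0 hα0 (levelSlopeAt 1 l α t₀)
        ht₀.1.le h ht.2
      obtain ⟨x', hx', r', hr', hxe'⟩ := levelCurve_mean_value one_pos hl0 hα0
        (levelSlopeAt 1 l α t₀) ht.1 ht1 le_rfl
      have i1 : 0 < levelSlopeAt 1 l α x - levelSlopeAt 1 l α t₀ := by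
        by_contra! h; have := mul_nonpos_of_nonpos_of_nonneg h hr.le; linarith
      have i2 : levelSlopeAt 1 l α x' - levelSlopeAt 1 l α t₀ < 0 := by
        by_contra! h; have := mul_nonneg h hr'.le; linarith
      rcases le_or_gt x c with hxc | hxc
      · have := hanti ht₀c ⟨ht₀.1.trans hx.1, hxc⟩ hx.1
        linarith
      · have := hmono ⟨hxc.le, hx.2.trans ht1⟩ ⟨hxc.le.trans (hx.2.trans hx'.1).le, hx'.2⟩
          (hx.2.trans hx'.1)
        linarith

end LevelCurve

/-! ### Separable sums with one inflection point on the simplex -/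

theorem _root_.StrictConvexOn.add_lt_add_of_spread {D : Set ℝ} {ψ : ℝ → ℝ}
    (h : StrictConvexOn ℝ D ψ) {a b x y : ℝ} (ha : a ∈ D) (hb : b ∈ D) (hbx : b < x)
    (hxa : x < a) (hsum : x + y = a + b) : ψ x + ψ y < ψ a + ψ b := by
  have hab : 0 < a - b := by linarith
  have h1 : 0 < (x - b) / (a - b) := div_pos (by linarith) hab
  have h2 : 0 < (a - x) / (a - b) := div_pos (by linarith) hab
  have h3 : (x - b) / (a - b) + (a - x) / (a - b) = 1 := by field_simp; ring
  have hne : a ≠ b := by linarith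
  have e1 := h.2 ha hb hne h1 h2 h3
  have e2 := h.2 ha hb hne h2 h1 (by linarith)
  have x1 : ((x - b) / (a - b)) • a + ((a - x) / (a - b)) • b = x := by
    simp only [smul_eq_mul]; field_simp; ring
  have x2 : ((a - x) / (a - b)) • a + ((x - b) / (a - b)) • b = y := by
    have : y = a + b - x := by linarith
    rw [this]; simp only [smul_eq_mul]; field_simp; ring
  rw [x1] at e1
  rw [x2] at e2
  simp only [smul_eq_mul] at e1 e2
  have h4 : (a - x) / (a - b) = 1 - (x - b) / (a - b) := by linarith
  rw [h4] at e1 e2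
  linarith

theorem strictConcave_strictConvex_of_inflection {ψ ψ' ψ'' : ℝ → ℝ} {s : ℝ} (hs : 0 < s)
    (hc : ContinuousOn ψ (Set.Ici 0)) (h1 : ∀ x, 0 < x → HasDerivAt ψ (ψ' x) x)
    (h2 : ∀ x, 0 < x → HasDerivAt ψ' (ψ'' x) x) (hneg : ∀ x, 0 < x → x < s → ψ'' x < 0)
    (hpos : ∀ x, s < x → 0 < ψ'' x) :
    StrictConcaveOn ℝ (Set.Icc 0 s) ψ ∧ StrictConvexOn ℝ (Set.Ici s) ψ := by
  have hd : Set.EqOn (deriv ψ) ψ' (Set.Ioi 0) := fun x hx => (h1 x hx).deriv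
  constructor
  · refine StrictAntiOn.strictConcaveOn_of_deriv (convex_Icc 0 s)
      (hc.mono Set.Icc_subset_Ici_self) ?_
    rw [interior_Icc]
    refine (strictAntiOn_of_deriv_neg (convex_Ioo 0 s)
      (fun x hx => (h2 x hx.1).continuousAt.continuousWithinAt) fun x hx => ?_).congr
      fun x hx => (hd hx.1).symm
    rw [interior_Ioo] at hx
    rw [(h2 x hx.1).deriv]
    exact hneg x hx.1 hx.2
  · refine StrictMonoOn.strictConvexOn_of_deriv (convex_Ici s)
      (hc.mono (Set.Ici_subset_Ici.2 hs.le)) ?_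
    rw [interior_Ici]
    refine (strictMonoOn_of_deriv_pos (convex_Ioi s)
      (fun x hx => (h2 x (hs.trans hx)).continuousAt.continuousWithinAt) fun x hx => ?_).congr
      fun x hx => (hd (hs.trans hx)).symm
    rw [interior_Ioi] at hx
    rw [(h2 x (hs.trans hx)).deriv]
    exact hpos x hx

section Structure

variable {ι : Type*} [Fintype ι]

/-- Replacing two entries of a probability vector by two others with the same sum. -/
theorem exists_pair_move {P : ι → ℝ} (hP : P ∈ stdSimplex ℝ ι) {i j : ι} (hij : i ≠ j) {a b : ℝ}
    (ha : 0 ≤ a) (hb : 0 ≤ b) (hab : a + b = P i + P j) :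
    ∃ Q ∈ stdSimplex ℝ ι, ∀ ψ : ℝ → ℝ,
      ∑ m, ψ (Q m) = ∑ m, ψ (P m) - (ψ (P i) + ψ (P j)) + (ψ a + ψ b) := by
  classical
  have key : ∀ ψ : ℝ → ℝ, ∑ m, ψ (Function.update (Function.update P i a) j b m) =
      ∑ m, ψ (P m) - (ψ (P i) + ψ (P j)) + (ψ a + ψ b) := by
    intro ψ
    have h : ∑ m, (ψ (Function.update (Function.update P i a) j b m) - ψ (P m)) =
        (ψ a - ψ (P i)) + (ψ b - ψ (P j)) := by
      rw [Fintype.sum_eq_add i j hij]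
      · simp [Function.update_of_ne hij]
      · rintro x ⟨hxi, hxj⟩
        simp [Function.update_of_ne hxi, Function.update_of_ne hxj]
    rw [Finset.sum_sub_distrib] at h
    linarith
  refine ⟨_, ⟨fun m => ?_, ?_⟩, key⟩
  · by_cases hmj : m = j
    · subst hmj; simpa using hb
    · rw [Function.update_of_ne hmj]
      by_cases hmi : m = i
      · subst hmi; simpa using ha
      · rw [Function.update_of_ne hmi]; exact hP.1 m
  · have := key id
    simp only [id] at this
    rw [this, hP.2]; linarith

/-- A separable sum whose summand is first concave and then convex is maximal on the simplex only
at a vector all of whose entries but a largest one coincide. -/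
theorem two_level_of_isMax {ψ : ℝ → ℝ} {s : ℝ} (hs : 0 ≤ s)
    (hcc : StrictConcaveOn ℝ (Set.Icc 0 s) ψ) (hcv : StrictConvexOn ℝ (Set.Ici s) ψ)
    {P : ι → ℝ} (hP : P ∈ stdSimplex ℝ ι)
    (hmax : ∀ Q ∈ stdSimplex ℝ ι, ∑ i, ψ (Q i) ≤ ∑ i, ψ (P i)) :
    ∃ q y, 0 ≤ q ∧ q ≤ y ∧
      ∀ f : ℝ → ℝ, ∑ i, f (P i) = f y + ((Fintype.card ι : ℝ) - 1) * f q := by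
  classical
  have hpair : ∀ i j, i ≠ j → ∀ a b, 0 ≤ a → 0 ≤ b → a + b = P i + P j →
      ψ a + ψ b ≤ ψ (P i) + ψ (P j) := by
    intro i j hij a b ha hb hab
    obtain ⟨Q, hQ, hQs⟩ := exists_pair_move hP hij ha hb hab
    have := hmax Q hQ
    rw [hQs ψ] at this
    linarith
  have hlow : ∀ i j, P i ≤ s → P j ≤ s → P i = P j := by
    intro i j hi hj
    by_contra hne
    have hij : i ≠ j := fun h => hne (by rw [h])
    have h1 := hcc.2 ⟨hP.1 i, hi⟩ ⟨hP.1 j, hj⟩ hne (half_pos one_pos) (half_pos one_pos)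
      (add_halves 1)
    have hi0 := hP.1 i
    have hj0 := hP.1 j
    have h2 := hpair i j hij ((1 / 2 : ℝ) • P i + (1 / 2 : ℝ) • P j)
      ((1 / 2 : ℝ) • P i + (1 / 2 : ℝ) • P j) (by positivity) (by positivity)
      (by simp only [smul_eq_mul]; ring)
    simp only [smul_eq_mul] at h1 h2
    linarith
  have hhigh : ∀ i j, i ≠ j → s < P i → P j ≤ s := by
    intro i j hij hi
    by_contra! hj
    have h1 := hcv.add_lt_add_of_spread (a := P i + P j - s) (b := s) (x := P i) (y := P j)
      (Set.mem_Ici.2 (by linarith)) Set.self_mem_Ici hi (by linarith) (by ring)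
    have h2 := hpair i j hij (P i + P j - s) s (by linarith) hs (by ring)
    linarith
  have hne : Nonempty ι := by
    by_contra h
    rw [not_nonempty_iff] at h
    have := hP.2
    simp at this
  obtain ⟨i₀, hi₀⟩ := Finite.exists_max P
  have hother : ∀ j, j ≠ i₀ → P j ≤ s := by
    intro j hj
    by_contra! h
    exact absurd (hhigh j i₀ hj h) (not_le.2 (h.trans_le (hi₀ j)))
  obtain ⟨q, hq0, hqy, hq⟩ : ∃ q, 0 ≤ q ∧ q ≤ P i₀ ∧ ∀ j, j ≠ i₀ → P j = q := by
    by_cases h : ∃ j, j ≠ i₀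
    · obtain ⟨j, hj⟩ := h
      exact ⟨P j, hP.1 j, hi₀ j, fun m hm => hlow m j (hother m hm) (hother j hj)⟩
    · push Not at h
      exact ⟨0, le_rfl, hP.1 i₀, fun j hj => absurd (h j) hj⟩
  refine ⟨q, P i₀, hq0, hqy, fun f => ?_⟩
  rw [← Finset.add_sum_erase _ _ (Finset.mem_univ i₀), Finset.sum_congr rfl (g := fun _ => f q)
    (fun j hj => by rw [hq j (Finset.ne_of_mem_erase hj)]), Finset.sum_const,
    Finset.card_erase_of_mem (Finset.mem_univ i₀), nsmul_eq_mul, Finset.card_univ,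
    Nat.cast_pred Fintype.card_pos]

/-- A separable sum whose summand is first concave and then convex is minimal on the simplex only
at a vector whose nonzero entries but a smallest one coincide. -/
theorem two_level_of_isMin {ψ : ℝ → ℝ} {s : ℝ} (hs : 0 ≤ s)
    (hcc : StrictConcaveOn ℝ (Set.Icc 0 s) ψ) (hcv : StrictConvexOn ℝ (Set.Ici s) ψ)
    {P : ι → ℝ} (hP : P ∈ stdSimplex ℝ ι)
    (hmin : ∀ Q ∈ stdSimplex ℝ ι, ∑ i, ψ (P i) ≤ ∑ i, ψ (Q i)) :
    ∃ k : ℕ, 1 ≤ k ∧ ∃ t y, 0 ≤ t ∧ t ≤ y ∧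
      ∀ f : ℝ → ℝ, f 0 = 0 → ∑ i, f (P i) = k * f y + f t := by
  classical
  have hpair : ∀ i j, i ≠ j → ∀ a b, 0 ≤ a → 0 ≤ b → a + b = P i + P j →
      ψ (P i) + ψ (P j) ≤ ψ a + ψ b := by
    intro i j hij a b ha hb hab
    obtain ⟨Q, hQ, hQs⟩ := exists_pair_move hP hij ha hb hab
    have := hmin Q hQ
    rw [hQs ψ] at this
    linarith
  have hhigh : ∀ i j, s ≤ P i → s ≤ P j → P i = P j := by
    intro i j hi hj
    by_contra hne
    have hij : i ≠ j := fun h => hne (by rw [h])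
    have h1 := hcv.2 hi hj hne (half_pos one_pos) (half_pos one_pos) (add_halves 1)
    have hi0 := hP.1 i
    have hj0 := hP.1 j
    have h2 := hpair i j hij ((1 / 2 : ℝ) • P i + (1 / 2 : ℝ) • P j)
      ((1 / 2 : ℝ) • P i + (1 / 2 : ℝ) • P j) (by positivity) (by positivity)
      (by simp only [smul_eq_mul]; ring)
    simp only [smul_eq_mul] at h1 h2
    linarith
  have hlow : ∀ i j, 0 < P i → P i < s → 0 < P j → P j < s → i = j := by
    intro i j hi his hj hjs
    by_contra hij
    rcases le_or_gt (P i + P j) s with h | h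
    · have h1 := hcc.neg.add_lt_add_of_spread (a := P i + P j) (b := 0) (x := P i) (y := P j)
        ⟨by linarith, h⟩ ⟨le_rfl, hs⟩ hi (by linarith) (by ring)
      have h2 := hpair i j hij (P i + P j) 0 (by linarith) le_rfl (by ring)
      simp only [Pi.neg_apply] at h1
      linarith
    · have h1 := hcc.neg.add_lt_add_of_spread (a := s) (b := P i + P j - s) (x := P i) (y := P j)
        ⟨hs, le_rfl⟩ ⟨by linarith, by linarith⟩ (by linarith) his (by ring)
      have h2 := hpair i j hij s (P i + P j - s) hs (by linarith) (by ring)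
      simp only [Pi.neg_apply] at h1
      linarith
  set K : Finset ι := Finset.univ.filter fun i => s ≤ P i with hK
  obtain ⟨t, ht0, hts, htsum⟩ : ∃ t, 0 ≤ t ∧ t ≤ s ∧ ∀ f : ℝ → ℝ, f 0 = 0 →
      ∑ i ∈ Finset.univ.filter (fun i => ¬ s ≤ P i), f (P i) = f t := by
    by_cases h : ∃ z, 0 < P z ∧ P z < s
    · obtain ⟨z, hz0, hzs⟩ := h
      refine ⟨P z, hz0.le, hzs.le, fun f hf => Finset.sum_eq_single z (fun i hi hiz => ?_)
        fun hz => ?_⟩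
      · rw [Finset.mem_filter, not_le] at hi
        rcases (hP.1 i).eq_or_lt with h0 | h0
        · rw [← h0, hf]
        · exact absurd (hlow i z h0 hi.2 hz0 hzs) hiz
      · exact absurd (Finset.mem_filter.2 ⟨Finset.mem_univ z, not_le.2 hzs⟩) hz
    · push Not at h
      refine ⟨0, le_rfl, hs, fun f hf => ?_⟩
      rw [hf]
      refine Finset.sum_eq_zero fun i hi => ?_
      rw [Finset.mem_filter, not_le] at hi
      rcases (hP.1 i).eq_or_lt with h0 | h0
      · rw [← h0, hf]
      · exact absurd (h i h0) (not_le.2 hi.2)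
  rcases K.eq_empty_or_nonempty with hKe | ⟨i₀, hi₀⟩
  · refine ⟨1, le_rfl, 0, t, le_rfl, ht0, fun f hf => ?_⟩
    rw [← Finset.sum_filter_add_sum_filter_not Finset.univ (fun i => s ≤ P i), ← hK, hKe,
      htsum f hf, hf]
    simp
  · have hi₀' : s ≤ P i₀ := (Finset.mem_filter.1 hi₀).2
    refine ⟨K.card, Finset.card_pos.2 ⟨i₀, hi₀⟩, t, P i₀, ht0, hts.trans hi₀', fun f hf => ?_⟩
    rw [← Finset.sum_filter_add_sum_filter_not Finset.univ (fun i => s ≤ P i), ← hK, htsum f hf,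
      Finset.sum_congr rfl (g := fun _ => f (P i₀)), Finset.sum_const, nsmul_eq_mul]
    intro i hi
    rw [hhigh i i₀ (Finset.mem_filter.1 hi).2 hi₀']

end Structure

/-- The summand left by linearization in the power sum. -/
theorem inflection_power_entropy {α b c : ℝ} (hα0 : 0 < α) (hα1 : α ≠ 1) (hb : 0 < b * (1 - α))
    (hc : 0 < c) : ∃ s, 0 ≤ s ∧
      StrictConcaveOn ℝ (Set.Icc 0 s) (fun p => c * p ^ α - b * Real.negMulLog p) ∧
      StrictConvexOn ℝ (Set.Ici s) (fun p => c * p ^ α - b * Real.negMulLog p) := by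
  have hα : 1 - α ≠ 0 := sub_ne_zero.2 hα1.symm
  have hα' : α - 1 ≠ 0 := sub_ne_zero.2 hα1
  have hd : 0 < b / (c * α * (1 - α)) := by
    have : b / (c * α * (1 - α)) = b * (1 - α) / (c * α * (1 - α) ^ 2) := by field_simp
    rw [this]; positivity
  set s := (b / (c * α * (1 - α))) ^ (1 / (α - 1)) with hs
  have hs0 : 0 < s := Real.rpow_pos_of_pos hd _
  have hsα : s ^ (α - 1) = b / (c * α * (1 - α)) := by
    rw [hs, ← Real.rpow_mul hd.le, one_div_mul_cancel hα', Real.rpow_one]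
  have hform : ∀ x : ℝ, 0 < x → c * (α * ((α - 1) * x ^ (α - 1 - 1))) - b * (-x⁻¹) =
      x⁻¹ * (c * α) * ((1 - α) * (s ^ (α - 1) - x ^ (α - 1))) := by
    intro x hx
    rw [hsα, Real.rpow_sub_one hx.ne' (α - 1)]
    field_simp
    ring
  refine ⟨s, hs0.le, strictConcave_strictConvex_of_inflection
    (ψ' := fun x => c * (α * x ^ (α - 1)) - b * (-Real.log x - 1))
    (ψ'' := fun x => c * (α * ((α - 1) * x ^ (α - 1 - 1))) - b * (-x⁻¹)) hs0 ?_ ?_ ?_ ?_ ?_⟩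
  · exact ((continuous_id.rpow_const fun _ => Or.inr hα0.le).const_mul c).continuousOn.sub
      (Real.continuous_negMulLog.const_mul b).continuousOn
  · intro x hx
    exact ((Real.hasDerivAt_rpow_const (Or.inl hx.ne')).const_mul c).sub
      ((Real.hasDerivAt_negMulLog hx.ne').const_mul b)
  · intro x hx
    exact (((Real.hasDerivAt_rpow_const (Or.inl hx.ne')).const_mul α).const_mul c).sub
      ((((Real.hasDerivAt_log hx.ne').neg).sub_const 1).const_mul b)
  · intro x hx hxs
    rw [hform x hx]
    refine mul_neg_of_pos_of_neg (by positivity) ?_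
    rcases lt_or_gt_of_ne hα1 with h | h
    · exact mul_neg_of_pos_of_neg (by linarith)
        (sub_neg.2 (Real.rpow_lt_rpow_of_neg hx hxs (by linarith)))
    · exact mul_neg_of_neg_of_pos (by linarith)
        (sub_pos.2 (Real.rpow_lt_rpow hx.le hxs (by linarith)))
  · intro x hxs
    have hx := hs0.trans hxs
    rw [hform x hx]
    refine mul_pos (by positivity) ?_
    rcases lt_or_gt_of_ne hα1 with h | h
    · exact mul_pos (by linarith) (sub_pos.2 (Real.rpow_lt_rpow_of_neg hs0 hxs (by linarith)))
    · exact mul_pos_of_neg_of_neg (by linarith)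
        (sub_neg.2 (Real.rpow_lt_rpow hs0.le hxs (by linarith)))

/-- The summand left by linearization of `S log S`, in the variable `t = x ^ α` with `γ = 1 / α`. -/
theorem inflection_escort {γ b c : ℝ} (hγ0 : 0 < γ) (hb : 0 < b * (γ - 1)) : ∃ s, 0 ≤ s ∧
      StrictConcaveOn ℝ (Set.Icc 0 s) (fun t => c * t ^ γ - b * Real.negMulLog (t ^ γ)) ∧
      StrictConvexOn ℝ (Set.Ici s) (fun t => c * t ^ γ - b * Real.negMulLog (t ^ γ)) := by
  have hb0 : b ≠ 0 := fun h => by simp [h] at hb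
  have hγ1 : γ - 1 ≠ 0 := fun h => by simp [h] at hb
  set s := Real.exp (-(c * (γ - 1) + b * (2 * γ - 1)) / (b * γ * (γ - 1))) with hs
  have hs0 : 0 < s := Real.exp_pos _
  have hsl : Real.log s = -(c * (γ - 1) + b * (2 * γ - 1)) / (b * γ * (γ - 1)) := Real.log_exp _
  have hform : ∀ x : ℝ, 0 < x →
      c * (γ * ((γ - 1) * x ^ (γ - 1 - 1))) - b * ((-(γ * x⁻¹)) * (γ * x ^ (γ - 1)) +
        (-(γ * Real.log x) - 1) * (γ * ((γ - 1) * x ^ (γ - 1 - 1)))) =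
      x ^ (γ - 1 - 1) * γ ^ 2 * (b * (γ - 1)) * (Real.log x - Real.log s) := by
    intro x hx
    rw [hsl, Real.rpow_sub_one hx.ne' (γ - 1)]
    field_simp
    ring
  refine ⟨s, hs0.le, strictConcave_strictConvex_of_inflection
    (ψ' := fun x => c * (γ * x ^ (γ - 1)) - b * ((-(γ * Real.log x) - 1) * (γ * x ^ (γ - 1))))
    (ψ'' := fun x => c * (γ * ((γ - 1) * x ^ (γ - 1 - 1))) -
      b * ((-(γ * x⁻¹)) * (γ * x ^ (γ - 1)) +
        (-(γ * Real.log x) - 1) * (γ * ((γ - 1) * x ^ (γ - 1 - 1))))) hs0 ?_ ?_ ?_ ?_ ?_⟩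
  · have h := (continuous_id (X := ℝ)).rpow_const (p := γ) fun _ => Or.inr hγ0.le
    exact ((h.const_mul c).sub ((Real.continuous_negMulLog.comp h).const_mul b)).continuousOn
  · intro x hx
    have h := Real.hasDerivAt_rpow_const (p := γ) (Or.inl hx.ne')
    have h2 := (Real.hasDerivAt_negMulLog (Real.rpow_pos_of_pos hx γ).ne').comp x h
    rw [Real.log_rpow hx] at h2
    exact (h.const_mul c).sub (h2.const_mul b)
  · intro x hx
    have h := (Real.hasDerivAt_rpow_const (p := γ - 1) (Or.inl hx.ne')).const_mul γ
    exact (h.const_mul c).sub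
      ((((((Real.hasDerivAt_log hx.ne').const_mul γ).neg).sub_const 1).mul h).const_mul b)
  · intro x hx hxs
    rw [hform x hx]
    exact mul_neg_of_pos_of_neg (by positivity) (sub_neg.2 (Real.log_lt_log hx hxs))
  · intro x hxs
    have hx := hs0.trans hxs
    rw [hform x hx]
    exact mul_pos (by positivity) (sub_pos.2 (Real.log_lt_log hs0 hxs))

/-! ### Extremizers of the norm minus a multiple of the entropy -/

section Extremizers

variable {ι : Type*} [Fintype ι] {α b : ℝ}

theorem shannonEntropy_eq_sum_negMulLog (p : ι → ℝ) :
    shannonEntropy p = ∑ i, Real.negMulLog (p i) := by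
  simp [shannonEntropy, Real.negMulLog]

theorem continuous_shannonEntropy : Continuous (shannonEntropy : (ι → ℝ) → ℝ) := by
  have := Real.continuous_negMulLog
  simp only [funext shannonEntropy_eq_sum_negMulLog]
  fun_prop

theorem continuous_lnorm (hα0 : 0 < α) : Continuous (lnorm α : (ι → ℝ) → ℝ) :=
  (continuous_finsetSum _ fun i _ =>
    (continuous_apply i).rpow_const fun _ => Or.inr hα0.le).rpow_const
      fun _ => Or.inr (by positivity)

theorem sum_rpow_pos {P : ι → ℝ} (hP : P ∈ stdSimplex ℝ ι) (β : ℝ) : 0 < ∑ i, P i ^ β := by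
  obtain ⟨i, -, hi⟩ := Finset.exists_ne_zero_of_sum_ne_zero (hP.2.trans_ne one_ne_zero)
  exact Finset.sum_pos' (fun j _ => Real.rpow_nonneg (hP.1 j) β)
    ⟨i, Finset.mem_univ i, Real.rpow_pos_of_pos (lt_of_le_of_ne (hP.1 i) hi.symm) β⟩

theorem lnorm_pos {P : ι → ℝ} (hP : P ∈ stdSimplex ℝ ι) : 0 < lnorm α P :=
  Real.rpow_pos_of_pos (sum_rpow_pos hP α) _

/-- A vector `t` of the simplex is the vector of `α`-th powers of an `ℓ_α`-normalised vector `x`;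
this expresses `‖·‖_α - b H` at the probability vector proportional to `x` by `x` itself. -/
theorem lnorm_sub_entropy_of_powers (hα0 : 0 < α) {t : ι → ℝ} (ht : t ∈ stdSimplex ℝ ι) :
    (fun i => t i ^ (1 / α) / ∑ j, t j ^ (1 / α)) ∈ stdSimplex ℝ ι ∧
      (∑ j, t j ^ (1 / α)) * (lnorm α (fun i => t i ^ (1 / α) / ∑ j, t j ^ (1 / α)) -
          b * shannonEntropy (fun i => t i ^ (1 / α) / ∑ j, t j ^ (1 / α))) =
        1 - b * ((∑ j, t j ^ (1 / α)) * Real.log (∑ j, t j ^ (1 / α)) +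
          ∑ j, Real.negMulLog (t j ^ (1 / α))) := by
  have hS := sum_rpow_pos ht (1 / α)
  set S := ∑ j, t j ^ (1 / α) with hSdef
  refine ⟨⟨fun i => div_nonneg (Real.rpow_nonneg (ht.1 i) _) hS.le, ?_⟩, ?_⟩
  · rw [← Finset.sum_div, div_self hS.ne']
  · have h1 : lnorm α (fun i => t i ^ (1 / α) / S) = S⁻¹ := by
      have : ∀ i, (t i ^ (1 / α) / S) ^ α = t i * S⁻¹ ^ α := by
        intro i
        rw [div_eq_mul_inv, Real.mul_rpow (Real.rpow_nonneg (ht.1 i) _) (inv_pos.2 hS).le,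
          ← Real.rpow_mul (ht.1 i), one_div_mul_cancel hα0.ne', Real.rpow_one]
      simp only [lnorm, this]
      rw [← Finset.sum_mul, ht.2, one_mul, ← Real.rpow_mul (inv_pos.2 hS).le,
        mul_one_div_cancel hα0.ne', Real.rpow_one]
    have h2 : shannonEntropy (fun i => t i ^ (1 / α) / S) =
        S⁻¹ * ∑ j, Real.negMulLog (t j ^ (1 / α)) + Real.log S := by
      have e' : ∀ i, Real.negMulLog (t i ^ (1 / α) / S) =
          S⁻¹ * Real.negMulLog (t i ^ (1 / α)) + t i ^ (1 / α) * Real.negMulLog S⁻¹ := fun i => by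
        rw [div_eq_mul_inv _ S, Real.negMulLog_mul]
      rw [shannonEntropy_eq_sum_negMulLog, Finset.sum_congr rfl fun i _ => e' i]
      rw [Finset.sum_add_distrib, ← Finset.mul_sum, ← Finset.sum_mul]
      have e : Real.negMulLog S⁻¹ = S⁻¹ * Real.log S := by
        rw [Real.negMulLog, Real.log_inv]; ring
      rw [← hSdef, e, mul_inv_cancel_left₀ hS.ne']
    rw [h1, h2]
    field_simp
    ring

/-- Every probability vector arises from a vector of powers as in `lnorm_sub_entropy_of_powers`. -/
theorem exists_powers (hα0 : 0 < α) {P : ι → ℝ} (hP : P ∈ stdSimplex ℝ ι) :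
    ∃ t ∈ stdSimplex ℝ ι, (fun i => t i ^ (1 / α) / ∑ j, t j ^ (1 / α)) = P := by
  have hN := lnorm_pos (α := α) hP
  have hT := sum_rpow_pos hP α
  have hx : ∀ i, ((P i / lnorm α P) ^ α) ^ (1 / α) = P i / lnorm α P := fun i => by
    rw [← Real.rpow_mul (div_nonneg (hP.1 i) hN.le), mul_one_div_cancel hα0.ne', Real.rpow_one]
  refine ⟨fun i => (P i / lnorm α P) ^ α,
    ⟨fun i => Real.rpow_nonneg (div_nonneg (hP.1 i) hN.le) _, ?_⟩, ?_⟩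
  · simp only [Real.div_rpow (hP.1 _) hN.le]
    rw [← Finset.sum_div, lnorm, ← Real.rpow_mul hT.le, one_div_mul_cancel hα0.ne', Real.rpow_one,
      div_self hT.ne']
  · funext i
    simp only [hx]
    rw [← Finset.sum_div, hP.2]
    field_simp

/-- The convex function `S log S` lies above its tangents. -/
theorem mul_log_tangent {S S₀ : ℝ} (hS : 0 < S) (hS₀ : 0 < S₀) :
    (1 + Real.log S₀) * S - S₀ ≤ S * Real.log S := by
  have h := Real.log_le_sub_one_of_pos (div_pos hS₀ hS)
  rw [Real.log_div hS₀.ne' hS.ne'] at h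
  have := mul_le_mul_of_nonneg_left h hS.le
  have e : S * (S₀ / S - 1) = S₀ - S := by field_simp
  rw [e] at this
  linarith

theorem rpow_tangent_le {γ T T₀ : ℝ} (hγ : 1 ≤ γ) (hT : 0 < T) (hT₀ : 0 < T₀) :
    T₀ ^ γ + γ * T₀ ^ (γ - 1) * (T - T₀) ≤ T ^ γ := by
  have h0 := div_pos hT hT₀
  have h := one_add_mul_self_le_rpow_one_add (s := T / T₀ - 1) (by linarith) hγ
  rw [add_sub_cancel, Real.div_rpow hT.le hT₀.le, le_div_iff₀ (by positivity)] at h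
  refine le_trans (le_of_eq ?_) h
  rw [Real.rpow_sub_one hT₀.ne']
  field_simp

theorem le_rpow_tangent {γ T T₀ : ℝ} (hγ0 : 0 ≤ γ) (hγ : γ ≤ 1) (hT : 0 < T) (hT₀ : 0 < T₀) :
    T ^ γ ≤ T₀ ^ γ + γ * T₀ ^ (γ - 1) * (T - T₀) := by
  have h0 := div_pos hT hT₀
  have h := rpow_one_add_le_one_add_mul_self (s := T / T₀ - 1) (by linarith) hγ0 hγ
  rw [add_sub_cancel, Real.div_rpow hT.le hT₀.le, div_le_iff₀ (by positivity)] at h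
  refine h.trans (le_of_eq ?_)
  rw [Real.rpow_sub_one hT₀.ne']
  field_simp

theorem sum_power_entropy (c : ℝ) (P : ι → ℝ) :
    ∑ i, (c * P i ^ α - b * Real.negMulLog (P i)) =
      c * ∑ i, P i ^ α - b * shannonEntropy P := by
  rw [shannonEntropy_eq_sum_negMulLog, Finset.sum_sub_distrib, Finset.mul_sum, Finset.mul_sum]

theorem sum_escort (c : ℝ) (t : ι → ℝ) :
    ∑ i, (c * t i ^ (1 / α) - b * Real.negMulLog (t i ^ (1 / α))) =
      c * ∑ i, t i ^ (1 / α) - b * ∑ i, Real.negMulLog (t i ^ (1 / α)) := by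
  rw [Finset.sum_sub_distrib, Finset.mul_sum, Finset.mul_sum]

/-- A maximizer of `‖·‖_α - b H` has one entry `y` and all other entries `q ≤ y`.
It also maximizes a separable functional: for `α < 1` the norm is a convex function of the power
sum, which may be replaced by its tangent; for `α > 1` the same is done with the convex function
`S log S` of the sum, after the power sum has been normalised instead of the sum. -/
theorem two_level_of_isMax_lnorm (hα0 : 0 < α) (hα1 : α ≠ 1) (hb : 0 < b * (1 - α)) {P : ι → ℝ}
    (hP : P ∈ stdSimplex ℝ ι) (hmax : ∀ Q ∈ stdSimplex ℝ ι,
      lnorm α Q - b * shannonEntropy Q ≤ lnorm α P - b * shannonEntropy P) :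
    ∃ q y, 0 ≤ q ∧ q ≤ y ∧
      ∀ f : ℝ → ℝ, ∑ i, f (P i) = f y + ((Fintype.card ι : ℝ) - 1) * f q := by
  rcases lt_or_gt_of_ne hα1 with h | h
  · have hT := sum_rpow_pos hP α
    have hγ : 1 ≤ 1 / α := by rw [le_div_iff₀ hα0]; linarith
    obtain ⟨s, hs, hcc, hcv⟩ := inflection_power_entropy hα0 hα1 hb
      (c := 1 / α * (∑ i, P i ^ α) ^ (1 / α - 1)) (by positivity)
    refine two_level_of_isMax hs hcc hcv hP fun Q hQ => ?_
    rw [sum_power_entropy, sum_power_entropy]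
    have h1 := hmax Q hQ
    have h2 := rpow_tangent_le hγ (sum_rpow_pos hQ α) hT
    unfold lnorm at h1
    linarith
  · obtain ⟨t, ht, rfl⟩ := exists_powers hα0 hP
    have hb0 : b < 0 := by
      by_contra! hb'; nlinarith
    have hS := sum_rpow_pos ht (1 / α)
    set S := ∑ j, t j ^ (1 / α) with hSdef
    set a := lnorm α (fun i => t i ^ (1 / α) / S) - b * shannonEntropy (fun i => t i ^ (1 / α) / S)
      with ha
    have hγ1 : 1 / α < 1 := by rw [div_lt_one hα0]; exact h
    obtain ⟨s, hs, hcc, hcv⟩ := inflection_escort (γ := 1 / α) (b := b)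
      (c := -b * (1 + Real.log S) - a) (by positivity)
      (mul_pos_of_neg_of_neg hb0 (by linarith))
    obtain ⟨q, y, hq0, hqy, hf⟩ := two_level_of_isMax hs hcc hcv ht fun t' ht' => by
      rw [sum_escort, sum_escort, ← hSdef]
      have hS' := sum_rpow_pos ht' (1 / α)
      obtain ⟨hm', he'⟩ := lnorm_sub_entropy_of_powers (b := b) hα0 ht'
      have he := (lnorm_sub_entropy_of_powers (b := b) hα0 ht).2
      rw [← hSdef, ← ha] at he
      have h1 := mul_le_mul_of_nonneg_left (hmax _ hm') hS'.le
      rw [he'] at h1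
      have h2 := mul_le_mul_of_nonneg_left (mul_log_tangent hS' hS) (neg_pos.2 hb0).le
      linarith
    refine ⟨q ^ (1 / α) / S, y ^ (1 / α) / S, by positivity,
      div_le_div_of_nonneg_right (Real.rpow_le_rpow hq0 hqy (by positivity)) hS.le, fun f => ?_⟩
    exact hf fun x => f (x ^ (1 / α) / S)

/-- A minimizer of `‖·‖_α - b H` has `k` entries `y`, one entry `t ≤ y`, and zeros. The reduction
to a separable functional is as for `two_level_of_isMax_lnorm`, with the two cases exchanged. -/
theorem two_level_of_isMin_lnorm (hα0 : 0 < α) (hα1 : α ≠ 1) (hb : 0 < b * (1 - α)) {P : ι → ℝ}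
    (hP : P ∈ stdSimplex ℝ ι) (hmin : ∀ Q ∈ stdSimplex ℝ ι,
      lnorm α P - b * shannonEntropy P ≤ lnorm α Q - b * shannonEntropy Q) :
    ∃ k : ℕ, 1 ≤ k ∧ ∃ t y, 0 ≤ t ∧ t ≤ y ∧
      ∀ f : ℝ → ℝ, f 0 = 0 → ∑ i, f (P i) = k * f y + f t := by
  rcases lt_or_gt_of_ne hα1 with h | h
  · obtain ⟨t, ht, rfl⟩ := exists_powers hα0 hP
    have hb0 : 0 < b := by
      by_contra! hb'; nlinarith
    have hS := sum_rpow_pos ht (1 / α)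
    set S := ∑ j, t j ^ (1 / α) with hSdef
    set a := lnorm α (fun i => t i ^ (1 / α) / S) - b * shannonEntropy (fun i => t i ^ (1 / α) / S)
      with ha
    have hγ1 : 1 < 1 / α := by rw [lt_div_iff₀ hα0]; linarith
    obtain ⟨s, hs, hcc, hcv⟩ := inflection_escort (γ := 1 / α) (b := b)
      (c := -b * (1 + Real.log S) - a) (by positivity) (mul_pos hb0 (by linarith))
    obtain ⟨k, hk, q, y, hq0, hqy, hf⟩ := two_level_of_isMin hs hcc hcv ht fun t' ht' => by
      rw [sum_escort, sum_escort, ← hSdef]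
      have hS' := sum_rpow_pos ht' (1 / α)
      obtain ⟨hm', he'⟩ := lnorm_sub_entropy_of_powers (b := b) hα0 ht'
      have he := (lnorm_sub_entropy_of_powers (b := b) hα0 ht).2
      rw [← hSdef, ← ha] at he
      have h1 := mul_le_mul_of_nonneg_left (hmin _ hm') hS'.le
      rw [he'] at h1
      have h2 := mul_le_mul_of_nonneg_left (mul_log_tangent hS' hS) hb0.le
      linarith
    refine ⟨k, hk, q ^ (1 / α) / S, y ^ (1 / α) / S, by positivity,
      div_le_div_of_nonneg_right (Real.rpow_le_rpow hq0 hqy (by positivity)) hS.le, fun f hf0 => ?_⟩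
    refine hf (fun x => f (x ^ (1 / α) / S)) ?_
    rw [Real.zero_rpow (by positivity), zero_div, hf0]
  · have hT := sum_rpow_pos hP α
    have hγ : 1 / α ≤ 1 := by rw [div_le_one hα0]; exact h.le
    obtain ⟨s, hs, hcc, hcv⟩ := inflection_power_entropy hα0 hα1 hb
      (c := 1 / α * (∑ i, P i ^ α) ^ (1 / α - 1)) (by positivity)
    refine two_level_of_isMin hs hcc hcv hP fun Q hQ => ?_
    rw [sum_power_entropy, sum_power_entropy]
    have h1 := hmin Q hQ
    have h2 := le_rpow_tangent (by positivity) hγ (sum_rpow_pos hQ α) hT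
    unfold lnorm at h1
    linarith

theorem continuous_lnorm_sub_entropy (hα0 : 0 < α) :
    Continuous fun P : ι → ℝ => lnorm α P - b * shannonEntropy P :=
  (continuous_lnorm hα0).sub (continuous_shannonEntropy.const_mul b)

theorem stdSimplex_nonempty [Nonempty ι] : (stdSimplex ℝ ι).Nonempty := by
  classical
  exact ⟨_, single_mem_stdSimplex ℝ (Classical.arbitrary ι)⟩

/-- An upper bound for `‖·‖_α - b H` on the vectors `v_n(t)` holds on the whole simplex. -/
theorem lnorm_sub_entropy_le_of_level [Nonempty ι] (hα0 : 0 < α) (hα1 : α ≠ 1)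
    (hb : 0 < b * (1 - α)) {C l : ℝ} (hl : l = (Fintype.card ι : ℝ) - 1)
    (hC : ∀ t ∈ Set.Icc 0 (1 / (1 + l)), levelNorm 1 l α t - b * levelEntropy 1 l t ≤ C)
    {P : ι → ℝ} (hP : P ∈ stdSimplex ℝ ι) : lnorm α P - b * shannonEntropy P ≤ C := by
  obtain ⟨M, hM, hmax⟩ := (isCompact_stdSimplex ℝ ι).exists_isMaxOn stdSimplex_nonempty
    (continuous_lnorm_sub_entropy (b := b) hα0).continuousOn
  obtain ⟨q, y, hq0, hqy, hf⟩ := two_level_of_isMax_lnorm hα0 hα1 hb hM fun Q hQ => hmax hQ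
  have hcard : (1 : ℝ) ≤ Fintype.card ι := by exact_mod_cast Fintype.card_pos (α := ι)
  have hsum := hf id
  simp only [id, hM.2] at hsum
  have hy : levelTop 1 l q = y := by rw [levelTop, hl]; linarith
  have hq : q ∈ Set.Icc 0 (1 / (1 + l)) := by
    refine ⟨hq0, ?_⟩
    rw [hl, le_div_iff₀ (by linarith)]
    linarith
  refine (hmax hP).trans ?_
  have h := hC q hq
  rw [levelNorm, levelEntropy, hy, hl, one_mul, one_mul] at h
  simp only [lnorm, shannonEntropy_eq_sum_negMulLog, hf fun x => x ^ α, hf Real.negMulLog]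
  exact h

/-- A lower bound for `‖·‖_α - b H` on the vectors with `k` entries `y`, one entry `t ≤ y`, and
zeros holds on the whole simplex. -/
theorem le_lnorm_sub_entropy_of_level [Nonempty ι] (hα0 : 0 < α) (hα1 : α ≠ 1)
    (hb : 0 < b * (1 - α)) {C : ℝ}
    (hC : ∀ k : ℕ, 1 ≤ k → ∀ t ∈ Set.Icc 0 (1 / ((k : ℝ) + 1)),
      C ≤ levelNorm k 1 α t - b * levelEntropy k 1 t)
    {P : ι → ℝ} (hP : P ∈ stdSimplex ℝ ι) : C ≤ lnorm α P - b * shannonEntropy P := by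
  obtain ⟨M, hM, hmin⟩ := (isCompact_stdSimplex ℝ ι).exists_isMinOn stdSimplex_nonempty
    (continuous_lnorm_sub_entropy (b := b) hα0).continuousOn
  obtain ⟨k, hk, q, y, hq0, hqy, hf⟩ := two_level_of_isMin_lnorm hα0 hα1 hb hM fun Q hQ => hmin hQ
  have hk' : (1 : ℝ) ≤ k := by exact_mod_cast hk
  have hsum := hf id rfl
  simp only [id, hM.2] at hsum
  have hy : levelTop k 1 q = y := by
    rw [levelTop, div_eq_iff (by linarith)]; linarith
  have hq : q ∈ Set.Icc 0 (1 / ((k : ℝ) + 1)) := by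
    refine ⟨hq0, ?_⟩
    rw [le_div_iff₀ (by linarith)]
    nlinarith
  refine le_trans ?_ (hmin hP)
  have h := hC k hk q hq
  rw [levelNorm, levelEntropy, hy, one_mul, one_mul] at h
  simp only [lnorm, shannonEntropy_eq_sum_negMulLog, hf _ Real.negMulLog_zero,
    hf (fun x => x ^ α) (Real.zero_rpow hα0.ne')]
  exact h

end Extremizers

/-! ### Supporting lines from below -/

theorem u_mem_stdSimplex {n : ℕ} (hn : 0 < n) : u n ∈ stdSimplex ℝ (Fin n) := by
  have : (0 : ℝ) < n := by exact_mod_cast hn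
  refine ⟨fun i => by unfold u; positivity, ?_⟩
  simp [u, this.ne']

theorem lnorm_u {n : ℕ} (hn : 0 < n) {α : ℝ} (hα0 : 0 < α) :
    lnorm α (u n) = (n : ℝ) ^ (1 / α - 1) := by
  have h : (0 : ℝ) < n := by exact_mod_cast hn
  have e : (n : ℝ) * (n : ℝ) ^ (-α) = (n : ℝ) ^ (1 - α) := by
    rw [sub_eq_add_neg, Real.rpow_add h, Real.rpow_one]
  simp only [lnorm, u, Finset.sum_const, Finset.card_univ, Fintype.card_fin, nsmul_eq_mul]
  rw [one_div (n : ℝ), Real.inv_rpow h.le, ← Real.rpow_neg h.le, e, ← Real.rpow_mul h.le]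
  congr 1
  field_simp

theorem shannonEntropy_u {n : ℕ} (hn : 0 < n) : shannonEntropy (u n) = Real.log n := by
  have h : (0 : ℝ) < n := by exact_mod_cast hn
  simp only [shannonEntropy, u, Finset.sum_const, Finset.card_univ, Fintype.card_fin,
    nsmul_eq_mul, one_div, Real.log_inv]
  field_simp

section LowerBound

/-- The slope of the line through the points of `u_m` and `u_{m+1}`. -/
noncomputable def uniformSlope (m : ℕ) (α : ℝ) : ℝ :=
  (((m : ℝ) + 1) ^ (1 / α - 1) - (m : ℝ) ^ (1 / α - 1)) / (Real.log ((m : ℝ) + 1) - Real.log m)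

/-- The value at `h = 0` of the line through the points of `u_m` and `u_{m+1}`. -/
noncomputable def uniformOffset (m : ℕ) (α : ℝ) : ℝ :=
  (m : ℝ) ^ (1 / α - 1) - uniformSlope m α * Real.log m

variable {m : ℕ} {α : ℝ}

theorem log_lt_log_succ (hm : 1 ≤ m) : Real.log m < Real.log ((m : ℝ) + 1) :=
  Real.log_lt_log (by exact_mod_cast hm) (by linarith)

theorem uniformOffset_eq (hm : 1 ≤ m) : uniformOffset m α =
    ((m : ℝ) + 1) ^ (1 / α - 1) - uniformSlope m α * Real.log ((m : ℝ) + 1) := by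
  have := sub_pos.2 (log_lt_log_succ hm)
  have h : uniformSlope m α * (Real.log ((m : ℝ) + 1) - Real.log m) =
      ((m : ℝ) + 1) ^ (1 / α - 1) - (m : ℝ) ^ (1 / α - 1) := by
    rw [uniformSlope, div_mul_cancel₀ _ this.ne']
  rw [uniformOffset]; linarith

theorem uniformSlope_mul_pos (hm : 1 ≤ m) (hα0 : 0 < α) (hα1 : α ≠ 1) :
    0 < uniformSlope m α * (1 - α) := by
  have hlog := sub_pos.2 (log_lt_log_succ hm)
  have hm0 : (0 : ℝ) < m := by exact_mod_cast hm
  rw [uniformSlope, div_mul_eq_mul_div]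
  refine div_pos ?_ hlog
  rcases lt_or_gt_of_ne hα1 with h | h
  · have hγ : 0 < 1 / α - 1 := by rw [sub_pos, lt_div_iff₀ hα0]; linarith
    exact mul_pos (sub_pos.2 (Real.rpow_lt_rpow hm0.le (by linarith) hγ)) (by linarith)
  · have hγ : 1 / α - 1 < 0 := by rw [sub_neg, div_lt_iff₀ hα0]; linarith
    exact mul_pos_of_neg_of_neg
      (sub_neg.2 (Real.rpow_lt_rpow_of_neg hm0 (by linarith) hγ)) (by linarith)

/-- As a function of its entropy `log j`, the norm `j ^ (1 / α - 1)` of `u_j` is convex, so all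
these points lie above the line through two consecutive ones. -/
theorem uniformOffset_le (hm : 1 ≤ m) {j : ℕ} (hj : 1 ≤ j) :
    uniformOffset m α ≤ (j : ℝ) ^ (1 / α - 1) - uniformSlope m α * Real.log j := by
  have hf : ConvexOn ℝ Set.univ fun x : ℝ => Real.exp (x * (1 / α - 1)) := by
    have := convexOn_exp.comp_linearMap (LinearMap.mulRight ℝ (1 / α - 1))
    simpa [Function.comp_def] using this
  have hm0 : (0 : ℝ) < m := by exact_mod_cast hm
  have hj0 : (0 : ℝ) < j := by exact_mod_cast hj
  have hm1 : (0 : ℝ) < (m : ℝ) + 1 := by linarith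
  have hlog := log_lt_log_succ hm
  have hval : uniformSlope m α = (Real.exp (Real.log ((m : ℝ) + 1) * (1 / α - 1)) -
      Real.exp (Real.log m * (1 / α - 1))) / (Real.log ((m : ℝ) + 1) - Real.log m) := by
    rw [uniformSlope, Real.rpow_def_of_pos hm0, Real.rpow_def_of_pos hm1]
  rcases lt_trichotomy j m with h | h | h
  · have hlt : Real.log j < Real.log m := Real.log_lt_log hj0 (by exact_mod_cast h)
    have := hf.slope_mono_adjacent (Set.mem_univ _) (Set.mem_univ _) hlt hlog
    rw [← hval, div_le_iff₀ (sub_pos.2 hlt)] at this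
    rw [uniformOffset, Real.rpow_def_of_pos hm0, Real.rpow_def_of_pos hj0]
    linarith
  · rw [h, uniformOffset]
  · have hle : (m : ℝ) + 1 ≤ j := by exact_mod_cast h
    rcases hle.eq_or_lt with he | hlt'
    · rw [← he, uniformOffset_eq hm]
    · have hlt : Real.log ((m : ℝ) + 1) < Real.log j := Real.log_lt_log hm1 hlt'
      have := hf.slope_mono_adjacent (Set.mem_univ _) (Set.mem_univ _) hlog hlt
      rw [← hval, le_div_iff₀ (sub_pos.2 hlt)] at this
      rw [uniformOffset_eq hm, Real.rpow_def_of_pos hm1, Real.rpow_def_of_pos hj0]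
      linarith

/-- The point of every probability vector lies above each of the lines that form the lower
bound. -/
theorem uniformOffset_le_lnorm_sub {ι : Type*} [Fintype ι] [Nonempty ι] (hm : 1 ≤ m)
    (hα0 : 0 < α) (hα1 : α ≠ 1) {P : ι → ℝ} (hP : P ∈ stdSimplex ℝ ι) :
    uniformOffset m α ≤ lnorm α P - uniformSlope m α * shannonEntropy P := by
  refine le_lnorm_sub_entropy_of_level hα0 hα1 (uniformSlope_mul_pos hm hα0 hα1)
    (fun k hk t ht => ?_) hP
  have hk1 : (1 : ℝ) ≤ k := by exact_mod_cast hk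
  have hk0 : (0 : ℝ) < k := by linarith
  refine levelCurve_chord one_pos hk1 hα0 hα1 ?_ ?_ ht
  · have e1 : levelNorm k 1 α 0 = lnorm α (u k) := by
      simp [levelNorm, levelTop, lnorm, u, hα0.ne']
    have e2 : levelEntropy k 1 0 = shannonEntropy (u k) := by
      simp [levelEntropy, levelTop, shannonEntropy_eq_sum_negMulLog, u]
    rw [e1, e2, lnorm_u hk hα0, shannonEntropy_u hk]
    exact uniformOffset_le hm hk
  · rw [levelNorm_end hk0 one_pos hα0, levelEntropy_end hk0 one_pos]
    exact_mod_cast uniformOffset_le (α := α) hm (Nat.le_add_left 1 k)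

/-- On `[log m, log (m + 1)]` the lower bound is the line through the points of `u_m` and
`u_{m+1}`. -/
theorem Lmin_eq (hm : 1 ≤ m) (hα0 : 0 < α) {h : ℝ} (h0 : Real.log m ≤ h)
    (h1 : h ≤ Real.log ((m : ℝ) + 1)) :
    Lmin α h = uniformOffset m α + uniformSlope m α * h := by
  have hm0 : (0 : ℝ) < m := by exact_mod_cast hm
  have hm1 : (0 : ℝ) < (m : ℝ) + 1 := by linarith
  have aux : ∀ j : ℕ, 1 ≤ j → ⌊Real.exp h⌋₊ = j →
      Lmin α h = uniformOffset j α + uniformSlope j α * h := by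
    intro j hj hfl
    have hlog := sub_pos.2 (log_lt_log_succ hj)
    simp only [Lmin]
    rw [hfl, lnorm_u hj hα0, lnorm_u (Nat.succ_pos j) hα0, uniformOffset, uniformSlope]
    push_cast
    field_simp
    ring
  rcases h1.eq_or_lt with he | hlt
  · -- at the right end `⌊exp h⌋` is already `m + 1`
    have hfl : ⌊Real.exp h⌋₊ = m + 1 := by
      rw [he, Real.exp_log hm1]; exact_mod_cast Nat.floor_natCast (R := ℝ) (m + 1)
    rw [aux (m + 1) (by omega) hfl, uniformOffset, uniformOffset_eq hm, he]
    push_cast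
    ring
  · refine aux m hm ((Nat.floor_eq_iff (Real.exp_pos h).le).2 ⟨?_, ?_⟩)
    · exact (Real.log_le_iff_le_exp hm0).1 h0
    · exact (Real.lt_log_iff_exp_lt hm1).1 hlt

theorem exists_log_le_le_log {n : ℕ} (hn : 2 ≤ n) {h : ℝ} (hh : h ∈ Set.Icc 0 (Real.log n)) :
    ∃ m : ℕ, 1 ≤ m ∧ m < n ∧ Real.log m ≤ h ∧ h ≤ Real.log ((m : ℝ) + 1) := by
  have hn0 : (0 : ℝ) < n := by positivity
  rcases hh.2.eq_or_lt with he | hlt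
  · refine ⟨n - 1, by omega, by omega, ?_, ?_⟩
    · rw [he]
      exact Real.log_le_log (by exact_mod_cast (by omega : 0 < n - 1))
        (by exact_mod_cast Nat.sub_le n 1)
    · rw [he, Nat.cast_sub (by omega)]; simp
  · have h1 : 1 ≤ Real.exp h := Real.one_le_exp hh.1
    have hfl : 1 ≤ ⌊Real.exp h⌋₊ := Nat.one_le_floor_iff _ |>.2 h1
    refine ⟨⌊Real.exp h⌋₊, hfl, ?_, ?_, ?_⟩
    · rw [Nat.floor_lt (Real.exp_pos h).le]
      exact (Real.lt_log_iff_exp_lt hn0).1 hlt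
    · rw [Real.log_le_iff_le_exp (by exact_mod_cast hfl)]
      exact Nat.floor_le (Real.exp_pos h).le
    · rw [Real.le_log_iff_exp_le (by positivity)]
      exact (Nat.lt_floor_add_one _).le

end LowerBound

/-! ### Extreme values of the entropy -/

section Entropy

variable {ι : Type*} [Fintype ι]

theorem le_one_of_mem_stdSimplex {P : ι → ℝ} (hP : P ∈ stdSimplex ℝ ι) (i : ι) : P i ≤ 1 :=
  hP.2 ▸ Finset.single_le_sum (fun j _ => hP.1 j) (Finset.mem_univ i)

theorem shannonEntropy_nonneg {P : ι → ℝ} (hP : P ∈ stdSimplex ℝ ι) : 0 ≤ shannonEntropy P := by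
  rw [shannonEntropy_eq_sum_negMulLog]
  exact Finset.sum_nonneg fun i _ => Real.negMulLog_nonneg (hP.1 i) (le_one_of_mem_stdSimplex hP i)

theorem lnorm_eq_one_of_shannonEntropy_eq_zero {α : ℝ} (hα0 : 0 < α) {P : ι → ℝ}
    (hP : P ∈ stdSimplex ℝ ι) (h : shannonEntropy P = 0) : lnorm α P = 1 := by
  rw [shannonEntropy_eq_sum_negMulLog, Finset.sum_eq_zero_iff_of_nonneg fun i _ =>
    Real.negMulLog_nonneg (hP.1 i) (le_one_of_mem_stdSimplex hP i)] at h
  have h2 : ∀ i, P i ^ α = P i := by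
    intro i
    have := h i (Finset.mem_univ i)
    rw [Real.negMulLog, mul_eq_zero, neg_eq_zero, Real.log_eq_zero] at this
    rcases this with h | h | h | h
    · rw [h, Real.zero_rpow hα0.ne']
    · rw [h, Real.zero_rpow hα0.ne']
    · rw [h, Real.one_rpow]
    · have := hP.1 i; linarith
  simp only [lnorm, h2]
  rw [hP.2, Real.one_rpow]

/-- The tangent of the concave function `negMulLog` at `1 / c`. -/
theorem negMulLog_le {c x : ℝ} (hc : 0 < c) (hx : 0 ≤ x) :
    Real.negMulLog x ≤ x * Real.log c + 1 / c - x ∧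
      (Real.negMulLog x = x * Real.log c + 1 / c - x → x = 1 / c) := by
  rcases hx.eq_or_lt with h | h
  · rw [← h]
    simp only [Real.negMulLog_zero, zero_mul, zero_add, sub_zero]
    exact ⟨by positivity, id⟩
  · have hpos : 0 < 1 / (c * x) := by positivity
    have e1 : Real.log (1 / (c * x)) = -Real.log c - Real.log x := by
      rw [one_div, Real.log_inv, Real.log_mul hc.ne' h.ne']; ring
    have e2 : x * (1 / (c * x) - 1) = 1 / c - x := by field_simp
    have e3 : Real.negMulLog x = x * Real.log c + x * Real.log (1 / (c * x)) := by
      rw [e1, Real.negMulLog]; ring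
    constructor
    · have := mul_le_mul_of_nonneg_left (Real.log_le_sub_one_of_pos hpos) hx
      linarith
    · intro heq
      by_contra hne
      have hne' : 1 / (c * x) ≠ 1 := by
        intro h1
        rw [div_eq_iff (by positivity), one_mul] at h1
        exact hne (by rw [eq_div_iff hc.ne']; linarith)
      have := mul_lt_mul_of_pos_left (Real.log_lt_sub_one_of_pos hpos hne') h
      linarith

theorem sum_linear_bound [Nonempty ι] {P : ι → ℝ} (hP : P ∈ stdSimplex ℝ ι) :
    ∑ i, (P i * Real.log (Fintype.card ι) + 1 / (Fintype.card ι : ℝ) - P i) =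
      Real.log (Fintype.card ι) := by
  have hc : (0 : ℝ) < Fintype.card ι := by exact_mod_cast Fintype.card_pos (α := ι)
  rw [Finset.sum_sub_distrib, Finset.sum_add_distrib, ← Finset.sum_mul, hP.2, Finset.sum_const,
    Finset.card_univ, nsmul_eq_mul]
  field_simp
  ring

theorem shannonEntropy_le_log_card [Nonempty ι] {P : ι → ℝ} (hP : P ∈ stdSimplex ℝ ι) :
    shannonEntropy P ≤ Real.log (Fintype.card ι) := by
  have hc : (0 : ℝ) < Fintype.card ι := by exact_mod_cast Fintype.card_pos (α := ι)
  rw [shannonEntropy_eq_sum_negMulLog, ← sum_linear_bound hP]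
  exact Finset.sum_le_sum fun i _ => (negMulLog_le hc (hP.1 i)).1

theorem eq_uniform_of_shannonEntropy_eq [Nonempty ι] {P : ι → ℝ} (hP : P ∈ stdSimplex ℝ ι)
    (h : shannonEntropy P = Real.log (Fintype.card ι)) (i : ι) :
    P i = 1 / (Fintype.card ι : ℝ) := by
  have hc : (0 : ℝ) < Fintype.card ι := by exact_mod_cast Fintype.card_pos (α := ι)
  rw [shannonEntropy_eq_sum_negMulLog, ← sum_linear_bound hP,
    Finset.sum_eq_sum_iff_of_le fun i _ => (negMulLog_le hc (hP.1 i)).1] at h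
  exact (negMulLog_le hc (hP.1 i)).2 (h i (Finset.mem_univ i))

end Entropy

/-! ### The curve of the vectors `v_n(p)` -/

section UpperCurve

variable {n : ℕ} {α : ℝ}

theorem sum_v (hn : 1 ≤ n) (p : ℝ) (f : ℝ → ℝ) :
    ∑ i, f (v n p i) = f (levelTop 1 ((n : ℝ) - 1) p) + ((n : ℝ) - 1) * f p := by
  obtain ⟨k, rfl⟩ : ∃ k, n = k + 1 := ⟨n - 1, by omega⟩
  rw [Fin.sum_univ_succ]
  simp [v, levelTop]

theorem Hv_eq (hn : 1 ≤ n) : Hv n = levelEntropy 1 ((n : ℝ) - 1) := by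
  funext p
  rw [Hv, shannonEntropy_eq_sum_negMulLog, sum_v hn, levelEntropy, one_mul]

theorem lnorm_v (hn : 1 ≤ n) (p : ℝ) : lnorm α (v n p) = levelNorm 1 ((n : ℝ) - 1) α p := by
  rw [lnorm, sum_v hn p fun x => x ^ α, levelNorm, one_mul]

theorem v_mem_stdSimplex (hn : 2 ≤ n) {p : ℝ} (hp : p ∈ Set.Icc 0 (1 / (n : ℝ))) :
    v n p ∈ stdSimplex ℝ (Fin n) := by
  have hn0 : (0 : ℝ) < n := by positivity
  have h1 := hp.2
  rw [le_div_iff₀ hn0] at h1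
  refine ⟨fun i => ?_, ?_⟩
  · unfold v
    split_ifs
    · linarith [hp.1]
    · exact hp.1
  · have := sum_v (by omega : 1 ≤ n) p id
    simp only [id] at this
    rw [this, levelTop]; ring

theorem Hv_strictMonoOn (hn : 2 ≤ n) : StrictMonoOn (Hv n) (Set.Icc 0 (1 / (n : ℝ))) := by
  have hn2 : (2 : ℝ) ≤ n := by exact_mod_cast hn
  rw [Hv_eq (by omega)]
  have := levelEntropy_strictMonoOn (k := 1) (l := (n : ℝ) - 1) one_pos (by linarith)
  rwa [add_sub_cancel] at this

theorem continuous_Hv (hn : 2 ≤ n) : Continuous (Hv n) := by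
  rw [Hv_eq (by omega)]; exact continuous_levelEntropy

theorem Hv_zero (hn : 2 ≤ n) : Hv n 0 = 0 := by
  rw [Hv_eq (by omega), levelEntropy_one_zero]

theorem Hv_end (hn : 2 ≤ n) : Hv n (1 / (n : ℝ)) = Real.log n := by
  have hn2 : (2 : ℝ) ≤ n := by exact_mod_cast hn
  have := levelEntropy_end (k := 1) (l := (n : ℝ) - 1) one_pos (by linarith)
  rwa [add_sub_cancel, ← Hv_eq (by omega)] at this

theorem lnorm_v_end (hn : 2 ≤ n) (hα0 : 0 < α) :
    levelNorm 1 ((n : ℝ) - 1) α (1 / (n : ℝ)) = lnorm α (u n) := by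
  have hn2 : (2 : ℝ) ≤ n := by exact_mod_cast hn
  have := levelNorm_end (k := 1) (l := (n : ℝ) - 1) one_pos (by linarith) hα0
  rwa [add_sub_cancel, ← lnorm_u (by omega) hα0] at this

theorem HvInv_Hv (hn : 2 ≤ n) {p : ℝ} (hp : p ∈ Set.Icc 0 (1 / (n : ℝ))) :
    HvInv n (Hv n p) = p :=
  (Hv_strictMonoOn hn).injOn.leftInvOn_invFunOn hp

theorem vCurve_Hv (hn : 2 ≤ n) {p : ℝ} (hp : p ∈ Set.Icc 0 (1 / (n : ℝ))) :
    vCurve n α (Hv n p) = levelNorm 1 ((n : ℝ) - 1) α p := by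
  rw [vCurve, HvInv_Hv hn hp, lnorm_v (by omega)]

theorem surjOn_Hv (hn : 2 ≤ n) :
    Set.SurjOn (Hv n) (Set.Icc 0 (1 / (n : ℝ))) (Set.Icc 0 (Real.log n)) := by
  have := intermediate_value_Icc (show (0 : ℝ) ≤ 1 / (n : ℝ) by positivity)
    (continuous_Hv hn).continuousOn
  rwa [Hv_zero hn, Hv_end hn] at this

theorem HvInv_mem (hn : 2 ≤ n) {h : ℝ} (hh : h ∈ Set.Icc 0 (Real.log n)) :
    HvInv n h ∈ Set.Icc 0 (1 / (n : ℝ)) :=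
  Function.invFunOn_mem (surjOn_Hv hn hh)

theorem Hv_HvInv (hn : 2 ≤ n) {h : ℝ} (hh : h ∈ Set.Icc 0 (Real.log n)) :
    Hv n (HvInv n h) = h :=
  Function.invFunOn_eq (surjOn_Hv hn hh)

theorem Hv_mem_Ioo (hn : 2 ≤ n) {p : ℝ} (hp : p ∈ Set.Ioo 0 (1 / (n : ℝ))) :
    Hv n p ∈ Set.Ioo 0 (Real.log n) := by
  have h := Hv_strictMonoOn hn
  have he : (0 : ℝ) ≤ 1 / (n : ℝ) := by positivity
  rw [← Hv_zero hn, ← Hv_end hn]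
  exact ⟨h ⟨le_rfl, he⟩ ⟨hp.1.le, hp.2.le⟩ hp.1, h ⟨hp.1.le, hp.2.le⟩ ⟨he, le_rfl⟩ hp.2⟩

theorem continuousAt_HvInv (hn : 2 ≤ n) {p : ℝ} (hp : p ∈ Set.Ioo 0 (1 / (n : ℝ))) :
    ContinuousAt (HvInv n) (Hv n p) := by
  have hmem := Hv_mem_Ioo hn hp
  have hmono : MonotoneOn (HvInv n) (Set.Icc 0 (Real.log n)) := by
    intro a ha b hb hab
    by_contra! hlt
    have := Hv_strictMonoOn hn (HvInv_mem hn hb) (HvInv_mem hn ha) hlt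
    rw [Hv_HvInv hn ha, Hv_HvInv hn hb] at this
    linarith
  refine continuousAt_of_monotoneOn_of_image_mem_nhds hmono (Icc_mem_nhds hmem.1 hmem.2) ?_
  rw [HvInv_Hv hn ⟨hp.1.le, hp.2.le⟩]
  refine Filter.mem_of_superset (Ioo_mem_nhds hp.1 hp.2) fun q hq => ?_
  have hq' := Hv_mem_Ioo hn hq
  exact ⟨Hv n q, ⟨hq'.1.le, hq'.2.le⟩, HvInv_Hv hn ⟨hq.1.le, hq.2.le⟩⟩

/-- The derivative of the norm with respect to the entropy in the tangency equation. -/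
theorem deriv_vCurve (hn : 2 ≤ n) (hα0 : 0 < α) {p : ℝ} (hp : p ∈ Set.Ioo 0 (1 / (n : ℝ))) :
    deriv (vCurve n α) (Hv n p) = levelSlopeAt 1 ((n : ℝ) - 1) α p := by
  have hn2 : (2 : ℝ) ≤ n := by exact_mod_cast hn
  have hl : (0 : ℝ) < (n : ℝ) - 1 := by linarith
  have hp' : p ∈ Set.Ioo 0 (1 / (1 + ((n : ℝ) - 1))) := by rwa [add_sub_cancel]
  have hmem := Hv_mem_Ioo hn hp
  have hinv := HvInv_Hv hn ⟨hp.1.le, hp.2.le⟩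
  have hL := log_levelTop_div_pos one_pos hl hp'
  have hH : HasDerivAt (Hv n)
      (((n : ℝ) - 1) * Real.log (levelTop 1 ((n : ℝ) - 1) p / p)) (HvInv n (Hv n p)) := by
    rw [hinv, Hv_eq (by omega)]
    exact hasDerivAt_levelEntropy one_pos hl hp'
  have hI := hH.of_local_left_inverse (continuousAt_HvInv hn hp) (by positivity)
    (Filter.mem_of_superset (Icc_mem_nhds hmem.1 hmem.2) fun h hh => Hv_HvInv hn hh)
  have hN : HasDerivAt (levelNorm 1 ((n : ℝ) - 1) α) (levelSlopeAt 1 ((n : ℝ) - 1) α p *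
      (((n : ℝ) - 1) * Real.log (levelTop 1 ((n : ℝ) - 1) p / p))) (HvInv n (Hv n p)) := by
    rw [hinv]; exact hasDerivAt_levelNorm one_pos hl hα0 hp'
  have hc := hN.comp (Hv n p) hI
  have he : vCurve n α = levelNorm 1 ((n : ℝ) - 1) α ∘ HvInv n := by
    funext h
    exact lnorm_v (by omega) _
  rw [he, hc.deriv]
  field_simp

theorem isTangencyRoot_iff (hn : 2 ≤ n) (hα0 : 0 < α) {p : ℝ} :
    IsTangencyRoot n α p ↔
      p ∈ Set.Ioo 0 (1 / (n : ℝ)) ∧ tangencyGap 1 ((n : ℝ) - 1) α p = 0 := by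
  refine and_congr_right fun hp => ?_
  rw [deriv_vCurve hn hα0 hp, tangencyGap, add_sub_cancel, lnorm_v (by omega), ← Hv_eq (by omega),
    Hv_end hn, lnorm_v_end hn hα0]
  constructor <;> intro h <;> linarith

theorem existsUnique_isTangencyRoot (hn : 3 ≤ n) (hα0 : 0 < α) (hα1 : α ≠ 1) :
    ∃! p : ℝ, IsTangencyRoot n α p := by
  have hn3 : (3 : ℝ) ≤ n := by exact_mod_cast hn
  obtain ⟨p, hp, hp0, huniq, -⟩ :=
    exists_unique_tangency (l := (n : ℝ) - 1) (by linarith) hα0 hα1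
  rw [add_sub_cancel] at hp huniq
  exact ⟨p, (isTangencyRoot_iff (by omega) hα0).2 ⟨hp, hp0⟩, fun q hq =>
    huniq q ((isTangencyRoot_iff (by omega) hα0).1 hq).1
      ((isTangencyRoot_iff (by omega) hα0).1 hq).2⟩

theorem isTangencyRoot_pStar (hn : 3 ≤ n) (hα0 : 0 < α) (hα1 : α ≠ 1) :
    IsTangencyRoot n α (pStar n α) := by
  rw [pStar, if_neg (by omega)]
  exact Classical.epsilon_spec (existsUnique_isTangencyRoot hn hα0 hα1).exists

theorem pStar_mem (hn : 2 ≤ n) (hα0 : 0 < α) (hα1 : α ≠ 1) :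
    pStar n α ∈ Set.Ioc 0 (1 / (n : ℝ)) := by
  rcases hn.eq_or_lt with rfl | h
  · simp [pStar]
  · have := (isTangencyRoot_pStar h hα0 hα1).1
    exact ⟨this.1, this.2.le⟩

/-- Up to the parameter `p_n^*(α)`, the points of all probability vectors lie below the tangents
of the curve of the vectors `v_n(p)`. -/
theorem lnorm_sub_le_tangent (hn : 2 ≤ n) (hα0 : 0 < α) (hα1 : α ≠ 1) {p : ℝ}
    (hp : p ∈ Set.Ioo 0 (1 / (n : ℝ))) (hps : p ≤ pStar n α)
    {ι : Type*} [Fintype ι] [Nonempty ι] (hcard : Fintype.card ι = n) {P : ι → ℝ}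
    (hP : P ∈ stdSimplex ℝ ι) :
    lnorm α P - levelSlopeAt 1 ((n : ℝ) - 1) α p * shannonEntropy P ≤
      levelNorm 1 ((n : ℝ) - 1) α p - levelSlopeAt 1 ((n : ℝ) - 1) α p * Hv n p := by
  have hn2 : (2 : ℝ) ≤ n := by exact_mod_cast hn
  have hl : (0 : ℝ) < (n : ℝ) - 1 := by linarith
  have hp' : p ∈ Set.Ioo 0 (1 / (1 + ((n : ℝ) - 1))) := by rwa [add_sub_cancel]
  refine lnorm_sub_entropy_le_of_level hα0 hα1
    (levelSlope_mul_pos one_pos hl hα1 (log_levelTop_div_pos one_pos hl hp'))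
    (l := (n : ℝ) - 1) (by rw [hcard]) (fun t ht => ?_) hP
  rw [Hv_eq (by omega)]
  rcases hn.eq_or_lt with h2 | h3
  · refine levelCurve_le_tangent hl ?_ hα0 hα1 hp' ht
    rw [← h2]; norm_num
  · have hn3 : (3 : ℝ) ≤ n := by exact_mod_cast h3
    obtain ⟨q, -, -, huniq, htan⟩ :=
      exists_unique_tangency (l := (n : ℝ) - 1) (by linarith) hα0 hα1
    rw [add_sub_cancel] at huniq
    have hr := (isTangencyRoot_iff hn hα0).1 (isTangencyRoot_pStar h3 hα0 hα1)
    rw [huniq _ hr.1 hr.2] at hps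
    exact htan p ⟨hp.1, hps⟩ t ht

/-- By the tangency equation, the chord from the point of `v_n(p_n^*(α))` to the point of `u_n` is
the tangent at its left end. -/
theorem tangentLine_eq (hn : 3 ≤ n) (hα0 : 0 < α) (hα1 : α ≠ 1) (h : ℝ) :
    tangentLine n α h = levelNorm 1 ((n : ℝ) - 1) α (pStar n α) +
      levelSlopeAt 1 ((n : ℝ) - 1) α (pStar n α) * (h - Hv n (pStar n α)) := by
  have hr := isTangencyRoot_pStar hn hα0 hα1
  have hlt := (Hv_mem_Ioo (by omega) hr.1).2
  have he := hr.2
  rw [deriv_vCurve (by omega) hα0 hr.1] at he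
  have he' : lnorm α (u n) = levelNorm 1 ((n : ℝ) - 1) α (pStar n α) +
      (Real.log n - Hv n (pStar n α)) * levelSlopeAt 1 ((n : ℝ) - 1) α (pStar n α) := by
    rw [he, lnorm_v (by omega)]; ring
  have hne := (sub_pos.2 hlt).ne'
  simp only [tangentLine]
  rw [he', lnorm_v (by omega)]
  field_simp
  ring

end UpperCurve

/-! ### Bounds for expectations -/

section RandomVector

variable {Ω : Type*} [MeasurableSpace Ω] {ι : Type*} [Fintype ι] {μ : Measure Ω}
  [IsProbabilityMeasure μ] {V : Ω → ι → ℝ} {α : ℝ}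

theorem integrable_comp_of_mem_stdSimplex (hV : Measurable V)
    (hmem : ∀ ω, V ω ∈ stdSimplex ℝ ι) {F : (ι → ℝ) → ℝ} (hF : Continuous F) :
    Integrable (fun ω => F (V ω)) μ := by
  obtain ⟨C, hC⟩ := (isCompact_stdSimplex ℝ ι).exists_bound_of_continuousOn hF.continuousOn
  exact Integrable.of_bound (hF.measurable.comp hV).aestronglyMeasurable C
    (Filter.Eventually.of_forall fun ω => hC _ (hmem ω))

theorem integral_shannonEntropy_mem [Nonempty ι] (hV : Measurable V)
    (hmem : ∀ ω, V ω ∈ stdSimplex ℝ ι) :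
    ∫ ω, shannonEntropy (V ω) ∂μ ∈ Set.Icc 0 (Real.log (Fintype.card ι)) := by
  refine ⟨integral_nonneg fun ω => shannonEntropy_nonneg (hmem ω), ?_⟩
  have := integral_mono
    (integrable_comp_of_mem_stdSimplex (μ := μ) hV hmem continuous_shannonEntropy)
    (integrable_const _) fun ω => shannonEntropy_le_log_card (hmem ω)
  simpa using this

theorem integral_lnorm_sub (hα0 : 0 < α) (hV : Measurable V)
    (hmem : ∀ ω, V ω ∈ stdSimplex ℝ ι) (b : ℝ) :
    ∫ ω, (lnorm α (V ω) - b * shannonEntropy (V ω)) ∂μ =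
      ∫ ω, lnorm α (V ω) ∂μ - b * ∫ ω, shannonEntropy (V ω) ∂μ := by
  rw [integral_sub (integrable_comp_of_mem_stdSimplex hV hmem (continuous_lnorm hα0))
    ((integrable_comp_of_mem_stdSimplex hV hmem continuous_shannonEntropy).const_mul b),
    integral_const_mul]

theorem Lmin_le_integral [Nonempty ι] (hcard : 2 ≤ Fintype.card ι) (hα0 : 0 < α) (hα1 : α ≠ 1)
    (hV : Measurable V) (hmem : ∀ ω, V ω ∈ stdSimplex ℝ ι) :
    Lmin α (∫ ω, shannonEntropy (V ω) ∂μ) ≤ ∫ ω, lnorm α (V ω) ∂μ := by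
  obtain ⟨m, hm, -, h0, h1⟩ :=
    exists_log_le_le_log hcard (integral_shannonEntropy_mem (μ := μ) hV hmem)
  rw [Lmin_eq hm hα0 h0 h1]
  have := integral_mono (μ := μ) (integrable_const _)
    (integrable_comp_of_mem_stdSimplex hV hmem (continuous_lnorm_sub_entropy hα0))
    fun ω => uniformOffset_le_lnorm_sub hm hα0 hα1 (hmem ω)
  rw [integral_lnorm_sub hα0 hV hmem] at this
  simp only [integral_const, probReal_univ, one_smul] at this
  linarith

theorem integral_le_tangent [Nonempty ι] {n : ℕ} (hn : 2 ≤ n) (hcard : Fintype.card ι = n)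
    (hα0 : 0 < α) (hα1 : α ≠ 1) (hV : Measurable V) (hmem : ∀ ω, V ω ∈ stdSimplex ℝ ι) {p : ℝ}
    (hp : p ∈ Set.Ioo 0 (1 / (n : ℝ))) (hps : p ≤ pStar n α) :
    ∫ ω, lnorm α (V ω) ∂μ ≤ levelNorm 1 ((n : ℝ) - 1) α p + levelSlopeAt 1 ((n : ℝ) - 1) α p *
      (∫ ω, shannonEntropy (V ω) ∂μ - Hv n p) := by
  have := integral_mono (μ := μ)
    (integrable_comp_of_mem_stdSimplex hV hmem (continuous_lnorm_sub_entropy hα0))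
    (integrable_const _) fun ω => lnorm_sub_le_tangent hn hα0 hα1 hp hps hcard (hmem ω)
  rw [integral_lnorm_sub hα0 hV hmem] at this
  simp only [integral_const, probReal_univ, one_smul] at this
  linarith

theorem integral_le_Lmax [Nonempty ι] {n : ℕ} (hn : 2 ≤ n) (hcard : Fintype.card ι = n)
    (hα0 : 0 < α) (hα1 : α ≠ 1) (hV : Measurable V) (hmem : ∀ ω, V ω ∈ stdSimplex ℝ ι) :
    ∫ ω, lnorm α (V ω) ∂μ ≤ Lmax n α (∫ ω, shannonEntropy (V ω) ∂μ) := by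
  have hh := integral_shannonEntropy_mem (μ := μ) hV hmem
  rw [hcard] at hh
  have hint := integrable_comp_of_mem_stdSimplex (μ := μ) hV hmem continuous_shannonEntropy
  have hps := pStar_mem hn hα0 hα1
  have hn0 : (0 : ℝ) ≤ 1 / (n : ℝ) := by positivity
  set h := ∫ ω, shannonEntropy (V ω) ∂μ with hdef
  rw [Lmax]
  split_ifs with hle
  · -- the two end points of the entropy range force the entropy to be almost surely constant
    have hp := HvInv_mem hn hh
    have hHp := Hv_HvInv hn hh
    have hcurve : vCurve n α h = levelNorm 1 ((n : ℝ) - 1) α (HvInv n h) := lnorm_v (by omega) _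
    have hpps : HvInv n h ≤ pStar n α :=
      ((Hv_strictMonoOn hn).le_iff_le hp ⟨hps.1.le, hps.2⟩).1 (hHp.trans_le hle)
    rcases hp.1.eq_or_lt with h0 | h0
    · have hz : h = 0 := by rw [← hHp, ← h0, Hv_zero hn]
      have hae : ∀ᵐ ω ∂μ, shannonEntropy (V ω) = 0 := by
        rw [hz, eq_comm, integral_eq_zero_iff_of_nonneg
          (fun ω => shannonEntropy_nonneg (hmem ω)) hint] at hdef
        exact hdef
      have h1 : ∀ᵐ ω ∂μ, lnorm α (V ω) = 1 := hae.mono fun ω hω =>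
        lnorm_eq_one_of_shannonEntropy_eq_zero hα0 (hmem ω) hω
      rw [integral_congr_ae h1, hcurve, ← h0, levelNorm_one_zero hα0]
      simp
    · rcases hp.2.eq_or_lt with h1 | h1
      · have hz : h = Real.log n := by rw [← hHp, h1, Hv_end hn]
        have hae : ∀ᵐ ω ∂μ, Real.log n - shannonEntropy (V ω) = 0 := by
          have h2 : ∫ ω, (Real.log n - shannonEntropy (V ω)) ∂μ = 0 := by
            rw [integral_sub (integrable_const _) hint, ← hdef, hz]; simp
          refine (integral_eq_zero_iff_of_nonneg (fun ω => sub_nonneg.2 ?_)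
            ((integrable_const _).sub hint)).1 h2
          rw [← hcard]
          exact shannonEntropy_le_log_card (hmem ω)
        have h2 : ∀ᵐ ω ∂μ, lnorm α (V ω) = lnorm α (u n) := by
          filter_upwards [hae] with ω hω
          have h3 := eq_uniform_of_shannonEntropy_eq (hmem ω) (by rw [hcard]; linarith)
          simp only [lnorm, h3, u, Finset.sum_const, Finset.card_univ, Fintype.card_fin, hcard]
        rw [integral_congr_ae h2, hcurve, h1, lnorm_v_end hn hα0]
        simp
      · have := integral_le_tangent (μ := μ) hn hcard hα0 hα1 hV hmem ⟨h0, h1⟩ hpps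
        rw [hHp, ← hdef, sub_self, mul_zero, add_zero] at this
        rwa [hcurve]
  · rw [not_le] at hle
    rcases hn.eq_or_lt with h2 | h3
    · exfalso
      subst h2
      have e : pStar 2 α = 1 / ((2 : ℕ) : ℝ) := by simp [pStar]
      rw [e, Hv_end hn] at hle
      exact absurd hh.2 (not_le.2 hle)
    · rw [tangentLine_eq h3 hα0 hα1]
      exact integral_le_tangent hn hcard hα0 hα1 hV hmem (isTangencyRoot_pStar h3 hα0 hα1).1 le_rfl

end RandomVector

/-! ### Conditional distributions and binary conditions -/

section CondVec

variable {Ω : Type*} [MeasurableSpace Ω] {A : Type*} [Fintype A] [Nonempty A] [MeasurableSpace A]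
  [DiscreteMeasurableSpace A] {B : Type*} [MeasurableSpace B] (μ : Measure Ω)
  [IsProbabilityMeasure μ] (X : Ω → A) {Y : Ω → B}

theorem condVec_mem_stdSimplex (y : B) : condVec μ X Y y ∈ stdSimplex ℝ A := by
  refine ⟨fun x => measureReal_nonneg, ?_⟩
  simp [condVec]

theorem measurable_condVec : Measurable (condVec μ X Y) :=
  measurable_pi_iff.2 fun x =>
    (Kernel.measurable_coe _ (MeasurableSet.singleton x)).ennreal_toReal

end CondVec

section BinaryCondition

variable {n : ℕ} {Ω : Type*} [MeasurableSpace Ω] {μ : Measure Ω}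
  [IsProbabilityMeasure μ] {X : Ω → Fin n} {Y : Ω → Fin 2} {q : Fin 2 → Fin n → ℝ}

/-- The conditional law is pinned only at the values that `Y` takes with positive probability. -/
theorem condVec_eq_of_hasCondLaw [NeZero n] (h : HasCondLaw μ X Y q) {y : Fin 2}
    (hy : μ.real {ω | Y ω = y} ≠ 0) : condVec μ X Y y = q y := by
  obtain ⟨hX, hY, hq⟩ := h
  have e1 : μ.map Y {y} = μ {ω | Y ω = y} := Measure.map_apply hY (MeasurableSet.singleton y)
  have hy' : μ.map Y {y} ≠ 0 := by
    rw [e1]; intro h0; exact hy (by rw [measureReal_def, h0, ENNReal.toReal_zero])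
  funext x
  rw [condVec, measureReal_def, condDistrib_apply_of_ne_zero hX y hy',
    Measure.map_apply (hY.prodMk hX) (by measurability), ENNReal.toReal_mul, ENNReal.toReal_inv, e1]
  have e2 : (fun ω => (Y ω, X ω)) ⁻¹' ({y} ×ˢ {x}) = {ω | X ω = x ∧ Y ω = y} := by
    ext ω; simp [and_comm]
  rw [e2]
  change (μ.real {ω | Y ω = y})⁻¹ * μ.real {ω | X ω = x ∧ Y ω = y} = q y x
  rw [hq x y]
  field_simp

theorem integral_condVec_of_hasCondLaw [NeZero n] (h : HasCondLaw μ X Y q) (F : (Fin n → ℝ) → ℝ) :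
    ∫ ω, F (condVec μ X Y (Y ω)) ∂μ =
      μ.real {ω | Y ω = 0} * F (q 0) + μ.real {ω | Y ω = 1} * F (q 1) := by
  have hY := h.2.1
  have := Measure.isProbabilityMeasure_map (μ := μ) hY.aemeasurable
  have hterm : ∀ y, (μ.map Y).real {y} • F (condVec μ X Y y) = μ.real {ω | Y ω = y} * F (q y) := by
    intro y
    have e : (μ.map Y).real {y} = μ.real {ω | Y ω = y} := by
      rw [measureReal_def, Measure.map_apply hY (MeasurableSet.singleton y)]; rfl
    rw [e, smul_eq_mul]
    by_cases h0 : μ.real {ω | Y ω = y} = 0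
    · rw [h0, zero_mul, zero_mul]
    · rw [condVec_eq_of_hasCondLaw h h0]
  rw [← integral_map (f := fun y => F (condVec μ X Y y)) hY.aemeasurable
    (measurable_of_finite _).aestronglyMeasurable, integral_fintype Integrable.of_finite,
    Fin.sum_univ_two, hterm, hterm]

theorem measureReal_binary (hY : Measurable Y) :
    μ.real {ω | Y ω = 0} + μ.real {ω | Y ω = 1} = 1 := by
  have e : {ω | Y ω = 1} = {ω | Y ω = 0}ᶜ := by
    ext ω
    simp only [Set.mem_ofPred_eq, Set.mem_compl_iff]
    omega
  rw [e]
  exact probReal_add_probReal_compl (hY (MeasurableSet.singleton 0))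

theorem exists_hasCondLaw {r : ℝ} (hr : r ∈ Set.Icc (0 : ℝ) 1)
    (hq : ∀ y, q y ∈ stdSimplex ℝ (Fin n)) :
    ∃ P : ProbabilityMeasure (Fin n × Fin 2),
      HasCondLaw (P : Measure (Fin n × Fin 2)) Prod.fst Prod.snd q ∧
      (P : Measure (Fin n × Fin 2)).real {z | z.2 = 0} = r ∧
      (P : Measure (Fin n × Fin 2)).real {z | z.2 = 1} = 1 - r := by
  classical
  set ρ : Fin 2 → ℝ := ![r, 1 - r] with hρ
  have hρ0 : ∀ y, 0 ≤ ρ y := by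
    intro y
    fin_cases y
    · exact hr.1
    · exact sub_nonneg.2 hr.2
  have hg0 : ∀ z : Fin n × Fin 2, 0 ≤ ρ z.2 * q z.2 z.1 := fun z =>
    mul_nonneg (hρ0 _) ((hq _).1 _)
  have hmarg : ∀ y, ∑ x, ρ y * q y x = ρ y := fun y => by
    rw [← Finset.mul_sum, (hq y).2, mul_one]
  have hsum : ∑ z : Fin n × Fin 2, ENNReal.ofReal (ρ z.2 * q z.2 z.1) = 1 := by
    rw [← ENNReal.ofReal_sum_of_nonneg fun z _ => hg0 z, Fintype.sum_prod_type_right]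
    simp only [hmarg]
    simp [hρ]
  set p := PMF.ofFintype (fun z : Fin n × Fin 2 => ENNReal.ofReal (ρ z.2 * q z.2 z.1)) hsum with hp
  have hreal : ∀ S : Set (Fin n × Fin 2), p.toMeasure.real S =
      ∑ z : Fin n × Fin 2, if z ∈ S then ρ z.2 * q z.2 z.1 else 0 := by
    intro S
    rw [measureReal_def, PMF.toMeasure_apply_fintype,
      ENNReal.toReal_sum]
    · refine Finset.sum_congr rfl fun z _ => ?_
      by_cases hz : z ∈ S
      · rw [Set.indicator_of_mem hz, if_pos hz, hp, PMF.ofFintype_apply,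
          ENNReal.toReal_ofReal (hg0 z)]
      · rw [Set.indicator_of_notMem hz, if_neg hz, ENNReal.toReal_zero]
    · intro z _
      by_cases hz : z ∈ S
      · rw [Set.indicator_of_mem hz, hp, PMF.ofFintype_apply]; exact ENNReal.ofReal_ne_top
      · rw [Set.indicator_of_notMem hz]; exact ENNReal.zero_ne_top
  have hsnd : ∀ y, p.toMeasure.real {z | z.2 = y} = ρ y := by
    intro y
    rw [hreal, Fintype.sum_prod_type_right, Finset.sum_eq_single y]
    · simp [hmarg]
    · intro y' _ hne
      simp [hne]
    · simp
  refine ⟨⟨p.toMeasure, inferInstance⟩, ⟨measurable_fst, measurable_snd, fun x y => ?_⟩,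
    hsnd 0, hsnd 1⟩
  change p.toMeasure.real _ = p.toMeasure.real {z | z.2 = y} * _
  rw [hsnd, hreal, Finset.sum_eq_single (x, y)]
  · simp
  · rintro ⟨x', y'⟩ _ hne
    rw [if_neg]
    rintro ⟨h1, h2⟩
    exact hne (Prod.ext h1 h2)
  · simp

/-- At `p = 1 / j` the entry `1 - ⌊1 / p⌋ p` of `w_n(p)` vanishes. -/
theorem sum_w {j : ℕ} (hj : 1 ≤ j) (hjn : j ≤ n) (f : ℝ → ℝ) (hf : f 0 = 0) :
    ∑ i, f (w n (j : ℝ)⁻¹ i) = j * f (1 / (j : ℝ)) := by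
  have hj0 : (j : ℝ) ≠ 0 := by positivity
  have e : ∀ i : Fin n, f (w n (j : ℝ)⁻¹ i) = if i.val < j then f (1 / (j : ℝ)) else 0 := by
    intro i
    simp only [w, inv_inv, Nat.floor_natCast]
    split_ifs with h1 h2
    · rw [one_div]
    · rw [mul_inv_cancel₀ hj0, sub_self, hf]
    · exact hf
  rw [Finset.sum_congr rfl fun i _ => e i, Finset.sum_ite, Finset.sum_const_zero, add_zero,
    Finset.sum_const, nsmul_eq_mul]
  congr 2
  rw [Fin.card_filter_val_lt, min_eq_right hjn]

theorem w_mem_stdSimplex {j : ℕ} (hj : 1 ≤ j) (hjn : j ≤ n) :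
    w n (j : ℝ)⁻¹ ∈ stdSimplex ℝ (Fin n) := by
  have hj0 : (j : ℝ) ≠ 0 := by positivity
  refine ⟨fun i => ?_, ?_⟩
  · simp only [w, inv_inv, Nat.floor_natCast, mul_inv_cancel₀ hj0, sub_self]
    split_ifs <;> positivity
  · have := sum_w hj hjn id rfl
    simp only [id] at this
    rw [this]; field_simp

theorem lnorm_w {j : ℕ} (hj : 1 ≤ j) (hjn : j ≤ n) {α : ℝ} (hα0 : 0 < α) :
    lnorm α (w n (j : ℝ)⁻¹) = (j : ℝ) ^ (1 / α - 1) := by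
  rw [lnorm, sum_w hj hjn (fun x => x ^ α) (Real.zero_rpow hα0.ne'), ← lnorm_u hj hα0]
  simp [lnorm, u]

theorem shannonEntropy_w {j : ℕ} (hj : 1 ≤ j) (hjn : j ≤ n) :
    shannonEntropy (w n (j : ℝ)⁻¹) = Real.log j := by
  rw [shannonEntropy_eq_sum_negMulLog, sum_w hj hjn _ Real.negMulLog_zero, ← shannonEntropy_u hj,
    shannonEntropy_eq_sum_negMulLog]
  simp [u]

end BinaryCondition

/-! ### Attainment -/

section Attainment

variable {n : ℕ} [NeZero n] {α : ℝ} {Ω : Type*} [MeasurableSpace Ω] {μ : Measure Ω}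
  [IsProbabilityMeasure μ] {X : Ω → Fin n} {Y : Ω → Fin 2}

theorem condEntropy_minPair {m : ℕ} (hm : 1 ≤ m) (hmn : m < n)
    (h : HasCondLaw μ X Y (fun y => w n ((m : ℝ) + (y.val : ℝ))⁻¹)) :
    condEntropy μ X Y = μ.real {ω | Y ω = 0} * Real.log m +
      μ.real {ω | Y ω = 1} * Real.log ((m : ℝ) + 1) := by
  have e1 := shannonEntropy_w hm hmn.le
  have e2 := shannonEntropy_w (n := n) (Nat.le_add_left 1 m) hmn
  rw [condEntropy, integral_condVec_of_hasCondLaw h]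
  push_cast at e2
  simp [e1, e2]

theorem expNorm_minPair {m : ℕ} (hm : 1 ≤ m) (hmn : m < n) (hα0 : 0 < α)
    (h : HasCondLaw μ X Y (fun y => w n ((m : ℝ) + (y.val : ℝ))⁻¹)) :
    expNorm α μ X Y = μ.real {ω | Y ω = 0} * (m : ℝ) ^ (1 / α - 1) +
      μ.real {ω | Y ω = 1} * ((m : ℝ) + 1) ^ (1 / α - 1) := by
  have e1 := lnorm_w hm hmn.le hα0
  have e2 := lnorm_w (n := n) (Nat.le_add_left 1 m) hmn hα0
  rw [expNorm, integral_condVec_of_hasCondLaw h]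
  push_cast at e2
  simp [e1, e2]

theorem expNorm_eq_Lmin (hα0 : 0 < α) (h : IsMinPair μ X Y) :
    expNorm α μ X Y = Lmin α (condEntropy μ X Y) := by
  obtain ⟨m, hm, hmn, hlaw⟩ := h
  have hr := measureReal_binary (μ := μ) hlaw.2.1
  have h0 : 0 ≤ μ.real {ω | Y ω = 0} := measureReal_nonneg
  have h1 : 0 ≤ μ.real {ω | Y ω = 1} := measureReal_nonneg
  have hlog := log_lt_log_succ hm
  have hH := condEntropy_minPair hm hmn hlaw
  have e0 : μ.real {ω | Y ω = 0} = 1 - μ.real {ω | Y ω = 1} := by linarith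
  have hoff := uniformOffset_eq (α := α) hm
  rw [Lmin_eq hm hα0 (by rw [hH, e0]; nlinarith) (by rw [hH, e0]; nlinarith), hH,
    expNorm_minPair hm hmn hα0 hlaw, e0]
  have hoff' : uniformOffset m α = (m : ℝ) ^ (1 / α - 1) - uniformSlope m α * Real.log m := rfl
  linear_combination -(1 - μ.real {ω | Y ω = 1}) * hoff' - μ.real {ω | Y ω = 1} * hoff

theorem exists_minPair (hn : 2 ≤ n) (hα0 : 0 < α) {h : ℝ} (hh : h ∈ Set.Icc 0 (Real.log n)) :
    ∃ P : ProbabilityMeasure (Fin n × Fin 2),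
      IsMinPair (P : Measure (Fin n × Fin 2)) Prod.fst Prod.snd ∧
      condEntropy (P : Measure (Fin n × Fin 2)) Prod.fst Prod.snd = h ∧
      expNorm α (P : Measure (Fin n × Fin 2)) Prod.fst Prod.snd = Lmin α h := by
  obtain ⟨m, hm, hmn, h0, h1⟩ := exists_log_le_le_log hn hh
  have hlog := sub_pos.2 (log_lt_log_succ hm)
  have hr : (Real.log ((m : ℝ) + 1) - h) / (Real.log ((m : ℝ) + 1) - Real.log m) ∈
      Set.Icc (0 : ℝ) 1 :=
    ⟨div_nonneg (by linarith) hlog.le, (div_le_one hlog).2 (by linarith)⟩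
  obtain ⟨P, hlaw, hP0, hP1⟩ := exists_hasCondLaw
    (q := fun y : Fin 2 => w n ((m : ℝ) + (y.val : ℝ))⁻¹) hr fun y => by
      have := w_mem_stdSimplex (n := n) (j := m + y.val) (by omega) (by omega)
      push_cast at this
      exact this
  have hpair : IsMinPair (P : Measure (Fin n × Fin 2)) Prod.fst Prod.snd := ⟨m, hm, hmn, hlaw⟩
  have hH : condEntropy (P : Measure (Fin n × Fin 2)) Prod.fst Prod.snd = h := by
    rw [condEntropy_minPair hm hmn hlaw, hP0, hP1]
    field_simp
    ring
  exact ⟨P, hpair, hH, hH ▸ expNorm_eq_Lmin hα0 hpair⟩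

theorem integral_maxPair_const {p : ℝ} (h : HasCondLaw μ X Y (fun _ => v n p))
    (F : (Fin n → ℝ) → ℝ) : ∫ ω, F (condVec μ X Y (Y ω)) ∂μ = F (v n p) := by
  rw [integral_condVec_of_hasCondLaw h, ← add_mul, measureReal_binary h.2.1, one_mul]

theorem integral_maxPair_mix {p : ℝ}
    (h : HasCondLaw μ X Y (fun y => if y = 0 then v n p else u n)) (F : (Fin n → ℝ) → ℝ) :
    ∫ ω, F (condVec μ X Y (Y ω)) ∂μ =
      μ.real {ω | Y ω = 0} * F (v n p) + μ.real {ω | Y ω = 1} * F (u n) := by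
  rw [integral_condVec_of_hasCondLaw h]
  simp

theorem expNorm_eq_Lmax (hn : 2 ≤ n) (hα0 : 0 < α) (hα1 : α ≠ 1) (h : IsMaxPair α μ X Y) :
    expNorm α μ X Y = Lmax n α (condEntropy μ X Y) := by
  have hps := pStar_mem hn hα0 hα1
  rcases h with ⟨hle, p, hp, hlaw⟩ | ⟨hlt, hlaw⟩
  · have hH : condEntropy μ X Y = Hv n p := integral_maxPair_const hlaw _
    rw [Lmax, if_pos hle, hH, vCurve_Hv hn ⟨hp.1, hp.2.trans hps.2⟩, ← lnorm_v (by omega)]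
    exact integral_maxPair_const hlaw _
  · have hr := measureReal_binary (μ := μ) hlaw.2.1
    have hH : condEntropy μ X Y = μ.real {ω | Y ω = 0} * Hv n (pStar n α) +
        μ.real {ω | Y ω = 1} * Real.log n := by
      rw [← shannonEntropy_u (by omega : 0 < n)]
      exact integral_maxPair_mix hlaw _
    have hN : expNorm α μ X Y = μ.real {ω | Y ω = 0} * lnorm α (v n (pStar n α)) +
        μ.real {ω | Y ω = 1} * lnorm α (u n) := integral_maxPair_mix hlaw _
    have h0 : 0 ≤ μ.real {ω | Y ω = 0} := measureReal_nonneg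
    have e1 : μ.real {ω | Y ω = 1} = 1 - μ.real {ω | Y ω = 0} := by linarith
    rw [e1] at hH hN
    -- the interpolation weight is determined because `H(v_n(p^*)) < log n`
    have hle : Hv n (pStar n α) ≤ Real.log n := by
      rw [← Hv_end hn]
      exact (Hv_strictMonoOn hn).monotoneOn ⟨hps.1.le, hps.2⟩ ⟨by positivity, le_rfl⟩ hps.2
    have hne : Real.log n - Hv n (pStar n α) ≠ 0 := by
      intro h
      have : Real.log n = Hv n (pStar n α) := by linarith
      rw [hH, this] at hlt
      linarith
    have hlam : (Real.log n - condEntropy μ X Y) / (Real.log n - Hv n (pStar n α)) =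
        μ.real {ω | Y ω = 0} := by
      rw [div_eq_iff hne, hH]; ring
    rw [Lmax, if_neg (not_le.2 hlt), hN]
    simp only [tangentLine]
    rw [hlam]

theorem exists_maxPair (hn : 2 ≤ n) (hα0 : 0 < α) (hα1 : α ≠ 1) {h : ℝ}
    (hh : h ∈ Set.Icc 0 (Real.log n)) :
    ∃ P : ProbabilityMeasure (Fin n × Fin 2),
      IsMaxPair α (P : Measure (Fin n × Fin 2)) Prod.fst Prod.snd ∧
      condEntropy (P : Measure (Fin n × Fin 2)) Prod.fst Prod.snd = h ∧
      expNorm α (P : Measure (Fin n × Fin 2)) Prod.fst Prod.snd = Lmax n α h := by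
  have hps := pStar_mem hn hα0 hα1
  rcases le_or_gt h (Hv n (pStar n α)) with hle | hlt
  · have hp := HvInv_mem hn hh
    have hHp := Hv_HvInv hn hh
    have hpps : HvInv n h ≤ pStar n α :=
      ((Hv_strictMonoOn hn).le_iff_le hp ⟨hps.1.le, hps.2⟩).1 (hHp.trans_le hle)
    obtain ⟨P, hlaw, -, -⟩ := exists_hasCondLaw (r := 0) (q := fun _ => v n (HvInv n h))
      ⟨le_rfl, zero_le_one⟩ fun _ => v_mem_stdSimplex hn hp
    have hH : condEntropy (P : Measure (Fin n × Fin 2)) Prod.fst Prod.snd = h :=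
      (integral_maxPair_const hlaw _).trans hHp
    have hpair : IsMaxPair α (P : Measure (Fin n × Fin 2)) Prod.fst Prod.snd :=
      Or.inl ⟨hH.trans_le hle, _, ⟨hp.1, hpps⟩, hlaw⟩
    exact ⟨P, hpair, hH, hH ▸ expNorm_eq_Lmax hn hα0 hα1 hpair⟩
  · have hpos : 0 < Real.log n - Hv n (pStar n α) := by linarith [hh.2]
    obtain ⟨P, hlaw, hP0, hP1⟩ := exists_hasCondLaw
      (r := (Real.log n - h) / (Real.log n - Hv n (pStar n α)))
      (q := fun y => if y = 0 then v n (pStar n α) else u n)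
      ⟨div_nonneg (by linarith [hh.2]) hpos.le, (div_le_one hpos).2 (by linarith)⟩ fun y => by
        split_ifs
        · exact v_mem_stdSimplex hn ⟨hps.1.le, hps.2⟩
        · exact u_mem_stdSimplex (by omega)
    have hH : condEntropy (P : Measure (Fin n × Fin 2)) Prod.fst Prod.snd = h := by
      refine (integral_maxPair_mix hlaw _).trans ?_
      rw [hP0, hP1, shannonEntropy_u (by omega), ← Hv]
      field_simp
      ring
    have hpair : IsMaxPair α (P : Measure (Fin n × Fin 2)) Prod.fst Prod.snd :=
      Or.inr ⟨hH.symm ▸ hlt, hlaw⟩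
    exact ⟨P, hpair, hH, hH ▸ expNorm_eq_Lmax hn hα0 hα1 hpair⟩

end Attainment

end CondExtremes

theorem theorem4 (n : ℕ) [NeZero n] (hn : 2 ≤ n) (α : ℝ) (hα0 : 0 < α) (hα1 : α ≠ 1) :
    -- the tangency parameter is well defined
    (3 ≤ n → 1 / 2 ≤ α → ∃! p : ℝ, IsTangencyRoot n α p) ∧
    -- lower bound
    (∀ (Ω A B : Type*) [MeasurableSpace Ω] [Fintype A] [Nonempty A] [MeasurableSpace A]
        [DiscreteMeasurableSpace A] [MeasurableSpace B] (μ : Measure Ω) [IsProbabilityMeasure μ]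
        (X : Ω → A) (Y : Ω → B), Fintype.card A = n → Measurable X → Measurable Y →
        Lmin α (condEntropy μ X Y) ≤ expNorm α μ X Y) ∧
    -- upper bound
    (1 / 2 ≤ α ∨ n = 2 →
      ∀ (Ω A B : Type*) [MeasurableSpace Ω] [Fintype A] [Nonempty A] [MeasurableSpace A]
        [DiscreteMeasurableSpace A] [MeasurableSpace B] (μ : Measure Ω) [IsProbabilityMeasure μ]
        (X : Ω → A) (Y : Ω → B), Fintype.card A = n → Measurable X → Measurable Y →
        expNorm α μ X Y ≤ Lmax n α (condEntropy μ X Y)) ∧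
    -- the lower bound is attained by its two-point construction, at every entropy level
    (∀ (Ω : Type*) [MeasurableSpace Ω] (μ : Measure Ω) [IsProbabilityMeasure μ]
        (X : Ω → Fin n) (Y : Ω → Fin 2), IsMinPair μ X Y →
        expNorm α μ X Y = Lmin α (condEntropy μ X Y)) ∧
    (∀ h ∈ Set.Icc (0 : ℝ) (Real.log n), ∃ P : ProbabilityMeasure (Fin n × Fin 2),
        IsMinPair (P : Measure (Fin n × Fin 2)) Prod.fst Prod.snd ∧
        condEntropy (P : Measure (Fin n × Fin 2)) Prod.fst Prod.snd = h ∧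
        expNorm α (P : Measure (Fin n × Fin 2)) Prod.fst Prod.snd = Lmin α h) ∧
    -- the upper bound is attained by its two-point construction, at every entropy level
    (1 / 2 ≤ α ∨ n = 2 →
      (∀ (Ω : Type*) [MeasurableSpace Ω] (μ : Measure Ω) [IsProbabilityMeasure μ]
        (X : Ω → Fin n) (Y : Ω → Fin 2), IsMaxPair α μ X Y →
        expNorm α μ X Y = Lmax n α (condEntropy μ X Y)) ∧
      (∀ h ∈ Set.Icc (0 : ℝ) (Real.log n), ∃ P : ProbabilityMeasure (Fin n × Fin 2),
        IsMaxPair α (P : Measure (Fin n × Fin 2)) Prod.fst Prod.snd ∧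
        condEntropy (P : Measure (Fin n × Fin 2)) Prod.fst Prod.snd = h ∧
        expNorm α (P : Measure (Fin n × Fin 2)) Prod.fst Prod.snd = Lmax n α h)) := by
  refine ⟨fun h3 _ => existsUnique_isTangencyRoot h3 hα0 hα1, ?_, ?_, ?_, ?_, ?_⟩
  · intro Ω A B _ _ _ _ _ _ μ _ X Y hcard _ hY
    exact Lmin_le_integral (hn.trans_eq hcard.symm) hα0 hα1 ((measurable_condVec μ X).comp hY)
      fun ω => condVec_mem_stdSimplex μ X (Y ω)
  · intro _ Ω A B _ _ _ _ _ _ μ _ X Y hcard _ hY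
    exact integral_le_Lmax hn hcard hα0 hα1 ((measurable_condVec μ X).comp hY)
      fun ω => condVec_mem_stdSimplex μ X (Y ω)
  · intro Ω _ μ _ X Y h
    exact expNorm_eq_Lmin hα0 h
  · intro h hh
    exact exists_minPair hn hα0 hh
  · intro _
    exact ⟨fun Ω _ μ _ X Y h => expNorm_eq_Lmax hn hα0 hα1 h, fun h hh =>
      exists_maxPair hn hα0 hα1 hh⟩
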